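/- Let $I$ be a finite set and let $\Delta$ be a (non-empty) building whose type is a right-angled Coxeter matrix $(m_{ij})_{i,j\in I}$, that is, $m_{ij}\in\{2,\infty\}$ for all $i\neq j$. For every $i\in I$ let $X_i$ be a set with $|X_i|\geq 2$, and suppose that $\Delta$ is semiregular with parameters $q_i=|X_i|$, i.e. every $i$-panel has cardinality $q_i$ (possibly infinite). View $\Delta$ as a chamber system, and let $\lambda=(\lambda_i)_{i\in I}\colon\Delta\to\prod_{i\in I}X_i$ be a legal colouring: for every $i$-panel $\mathcal P$, the restriction $\lambda_i|_{\mathcal P}\colon\mathcal P\to X_i$ is a bijection, and $\lambda_j|_{\mathcal P}$ is constant for every $j\neq i$. For every $i\in I$ let $F_i\leq\mathrm{Sym}(X_i)$ be an arbitrary permutation group. The universal group $U(\boldsymbol F)$ consists of all type-preserving automorphisms $g$ of $\Delta$ such that $\lambda_i|_{g\mathcal P}\circ g|_{\mathcal P}\circ(\lambda_i|_{\mathcal P})^{-1}\in F_i$ for every $i\in I$ and every $i$-panel $\mathcal P$. Let $J\subsetneq I$, and assume that if $I\setminus J$ consists of a single element $k$, then $k$ is not an isolated node of the Coxeter diagram,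 i.e. $m_{ik}=\infty$ for some $i\in I$. Theorem (primitivity). The group $U(\boldsymbol F)$ acts primitively on the set of $J$-residues of $\Delta$ if and only if the following three conditions hold: (i) $|I\setminus J|=1$, so that $I=J\sqcup\{k\}$ for some $k\in I$; (ii) $F_k$ is primitive and non-regular on $X_k$; (iii) $F_i$ is transitive on $X_i$ for every $i\in I$ with $m_{ik}=\infty$. Here an action is primitive if it is transitive and preserves no equivalence relation other than equality and the universal relation, and regular if it is transitive with trivial point stabilisers. -/

import Mathlib

open scoped Pointwise

/-- A Coxeter matrix is right-angled if `m i j ∈ {2, ∞}` for all `i ≠ j`.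
In Mathlib's convention the entry `∞` of a Coxeter matrix is encoded as `0`. -/
def CoxeterMatrix.IsRightAngled {I : Type*} (M : CoxeterMatrix I) : Prop :=
  ∀ i j, i ≠ j → M i j = 2 ∨ M i j = 0

/-- A permutation action is regular if it is transitive and all point stabilisers are trivial. -/
def IsRegularAction (G X : Type*) [Group G] [MulAction G X] : Prop :=
  MulAction.IsPretransitive G X ∧ ∀ x : X, MulAction.stabilizer G x = ⊥

/-- A chamber system over `I` with chamber set `C`: one equivalence relation for each `i : I`.
`Δ.equiv i c d` means that `c` and `d` are `i`-adjacent or equal. -/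
structure ChamberSystem (I C : Type*) where
  equiv : I → Setoid C

namespace ChamberSystem

variable {I C : Type*} (Δ : ChamberSystem I C)

/-- `Δ.IsGallery w c d`: there is a gallery of type `w` from `c` to `d`, that is, a sequence of
chambers in which consecutive chambers are distinct and `i`-adjacent, for the successive `i`
in the list `w`. -/
def IsGallery : List I → C → C → Prop
  | [], c, d => c = d
  | i :: w, c, d => ∃ e, c ≠ e ∧ Δ.equiv i c e ∧ IsGallery w e d

/-- The chambers that can be reached from `c` by a gallery whose type has all its entries
in `J`. -/
def residueOf (J : Set I) (c : C) : Set C :=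
  {d | ∃ w : List I, (∀ i ∈ w, i ∈ J) ∧ Δ.IsGallery w c d}

/-- The set of `J`-residues; each residue is identified with its set of chambers. -/
def Residue (J : Set I) : Type _ := {R : Set C // ∃ c, R = Δ.residueOf J c}

/-- A panel of type `i` is an `{i}`-residue. -/
abbrev Panel (i : I) : Type _ := Δ.Residue {i}

/-- `Δ` is a building of type `M`: it is non-empty, every panel contains at least two chambers,
and there is a Weyl distance `δ` with values in the Coxeter group of `M` such that, for every
reduced word `w`, there is a gallery of type `w` from `c` to `d` if and only if `δ c d` is the
element represented by `w`. -/
structure IsBuilding (M : CoxeterMatrix I) : Prop where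
  nonempty : Nonempty C
  two_le_panel : ∀ (i : I) (P : Δ.Panel i), P.1.Nontrivial
  exists_dist : ∃ δ : C → C → M.Group, ∀ w : List I, M.toCoxeterSystem.IsReduced w →
    ∀ c d, δ c d = M.toCoxeterSystem.wordProd w ↔ Δ.IsGallery w c d

/-- `Δ` is semiregular with parameters `q i = |X i| ≥ 2`: all `i`-panels have cardinality
`|X i|`. -/
def IsSemiregular (X : I → Type*) : Prop :=
  ∀ i, Nontrivial (X i) ∧ ∀ P : Δ.Panel i, Nonempty (P.1 ≃ X i)

/-- The group of type-preserving automorphisms. -/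
def Aut : Subgroup (Equiv.Perm C) where
  carrier := {g | ∀ i c d, Δ.equiv i (g c) (g d) ↔ Δ.equiv i c d}
  mul_mem' := by
    intro g h hg hh i c d
    exact (hg i (h c) (h d)).trans (hh i c d)
  one_mem' := fun _ _ _ => Iff.rfl
  inv_mem' := by
    intro g hg i c d
    have h := hg i (g⁻¹ c) (g⁻¹ d)
    simpa using h.symm

variable {Δ}

theorem isGallery_apply {g : Equiv.Perm C} (hg : g ∈ Δ.Aut) (w : List I) (c d : C) :
    Δ.IsGallery w (g c) (g d) ↔ Δ.IsGallery w c d := by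
  induction w generalizing c with
  | nil => exact g.injective.eq_iff
  | cons i w ih =>
    constructor
    · rintro ⟨e, hne, he, hw⟩
      obtain ⟨e, rfl⟩ := g.surjective e
      exact ⟨e, fun h => hne (congrArg g h), (hg i c e).1 he, (ih e).1 hw⟩
    · rintro ⟨e, hne, he, hw⟩
      exact ⟨g e, fun h => hne (g.injective h), (hg i c e).2 he, (ih e).2 hw⟩

theorem image_residueOf {g : Equiv.Perm C} (hg : g ∈ Δ.Aut) (J : Set I) (c : C) :
    g '' Δ.residueOf J c = Δ.residueOf J (g c) := by
  ext d
  constructor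
  · rintro ⟨e, ⟨w, hw, he⟩, rfl⟩
    exact ⟨w, hw, (isGallery_apply hg w c e).2 he⟩
  · rintro ⟨w, hw, hd⟩
    obtain ⟨e, rfl⟩ := g.surjective d
    exact ⟨e, ⟨w, hw, (isGallery_apply hg w c e).1 hd⟩, rfl⟩

/-- The automorphism group acts on the set of `J`-residues by `g • R = {g c | c ∈ R}`. -/
instance (J : Set I) : MulAction Δ.Aut (Δ.Residue J) where
  smul g R := ⟨g.1 '' R.1, by
    obtain ⟨c, hc⟩ := R.2
    exact ⟨g.1 c, by rw [hc, image_residueOf g.2]⟩⟩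
  one_smul R := Subtype.ext (Set.image_id R.1)
  mul_smul g h R := Subtype.ext (Set.image_comp g.1 h.1 R.1)

variable (Δ)

/-- A legal colouring `c ↦ (col c i)_i`: on every `i`-panel, the `i`-colour is a bijection
onto `X i`, and all other colours are constant. -/
structure LegalColouring (X : I → Type*) where
  col : C → ∀ i, X i
  bijective : ∀ (i : I) (P : Δ.Panel i), Function.Bijective (fun c : P.1 => col c i)
  constant : ∀ (i j : I), j ≠ i → ∀ P : Δ.Panel i, ∀ c ∈ P.1, ∀ d ∈ P.1, col c j = col d j

namespace LegalColouring

variable {Δ} {X : I → Type*} (L : Δ.LegalColouring X)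

/-- The bijection from an `i`-panel to the set of `i`-colours. -/
noncomputable def panelEquiv {i : I} (P : Δ.Panel i) : P.1 ≃ X i :=
  Equiv.ofBijective _ (L.bijective i P)

/-- The local action of the automorphism `g` at the `i`-panel `P`: apply the inverse of the
`i`-colouring of `P`, then `g : P → g • P`, then the `i`-colouring of `g • P`. -/
noncomputable def localAction (g : Δ.Aut) {i : I} (P : Δ.Panel i) : Equiv.Perm (X i) :=
  (L.panelEquiv P).symm.trans ((Equiv.image g.1 P.1).trans (L.panelEquiv (g • P)))

theorem localAction_col (g : Δ.Aut) {i : I} (P : Δ.Panel i) (c : C) (hc : c ∈ P.1) :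
    L.localAction g P (L.col c i) = L.col (g.1 c) i := by
  have h : (L.panelEquiv P).symm (L.col c i) = ⟨c, hc⟩ := by
    rw [Equiv.symm_apply_eq]
    rfl
  simp only [localAction, Equiv.trans_apply, h]
  rfl

theorem localAction_one {i : I} (P : Δ.Panel i) : L.localAction 1 P = 1 := by
  ext x
  obtain ⟨c, rfl⟩ := (L.panelEquiv P).surjective x
  exact L.localAction_col 1 P c.1 c.2

theorem localAction_mul (g h : Δ.Aut) {i : I} (P : Δ.Panel i) :
    L.localAction (g * h) P = L.localAction g (h • P) * L.localAction h P := by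
  ext x
  obtain ⟨c, rfl⟩ := (L.panelEquiv P).surjective x
  have e1 := L.localAction_col (g * h) P c.1 c.2
  have e2 := L.localAction_col h P c.1 c.2
  have e3 := L.localAction_col g (h • P) (h.1 c.1) ⟨c.1, c.2, rfl⟩
  rw [Equiv.Perm.mul_apply]
  exact e1.trans ((congrArg _ e2).trans e3).symm

/-- The universal group with local groups `F i`: all automorphisms whose local action at every
`i`-panel lies in `F i`, for every `i`. -/
def universalGroup (F : ∀ i, Subgroup (Equiv.Perm (X i))) : Subgroup Δ.Aut where
  carrier := {g | ∀ (i : I) (P : Δ.Panel i), L.localAction g P ∈ F i}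
  mul_mem' := by
    intro g h hg hh i P
    rw [localAction_mul]
    exact mul_mem (hg i _) (hh i P)
  one_mem' := by
    intro i P
    rw [localAction_one]
    exact one_mem _
  inv_mem' := by
    intro g hg i P
    have h := L.localAction_mul g g⁻¹ P
    rw [mul_inv_cancel, localAction_one] at h
    rw [eq_inv_of_mul_eq_one_right h.symm]
    exact inv_mem (hg i _)

end LegalColouring

end ChamberSystem

/-! A legal colouring turns galleries into runs of moves, where `move i x c` is the chamber of
colour `x` in the `i`-panel of `c`. In a right-angled Coxeter group a word is reduced unless two
equal letters cancel after commutations (`IsRightAngled.isReduced`). Hence a nonempty closed run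
either contains a stationary move or has two moves of one type that merge across commuting moves
(`exists_split_of_run_eq`). These shortenings survive recolouring, so permutations of the colours
extend to automorphisms (`exists_perm_recolouring`). They also show that a tree-wall of type `k`
cuts the building into wings indexed by `X k`: the map `π` of `exists_wing` changes only under
`k`-moves inside that wall. An automorphism may act on all wings but one while fixing that one
pointwise (`exists_wing_extension`).

Necessity: if a condition fails, an invariant relation on chambers contradicts primitivity. It is
generated by the moves of type in `J` and suitable `k`-moves (`moveSetoid`), or, for regular `F k`,
it is equality of `k`-colours. A colour or a map `π` shows that such a relation is not universal, or
that it does not lie inside the residues.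

Sufficiency: if an invariant relation joins two residues, some wall has the first chamber in one
wing and meets the second residue in another (`exists_wing_ne`). An element of `F k` fixing the
first colour and moving the second relates two distinct chambers of one `k`-panel. Primitivity of `F
k` then collapses this panel, and transitivity of the groups `F i` with `m i k = ∞` carries the
collapse to all `k`-panels. -/

namespace CoxeterMatrix

/-! ### Commutations and cancellations in right-angled Coxeter words -/

variable {I : Type*} (M : CoxeterMatrix I)

/-- The letter `i` can be moved to the front of the word by commutations. -/
def CanStart (i : I) : List I → Prop
  | [] => False
  | j :: u => j = i ∨ (M i j = 2 ∧ CanStart i u)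

/-- No letter of the word can be cancelled against another one after commutations. -/
def CommReduced : List I → Prop
  | [] => True
  | i :: u => ¬ M.CanStart i u ∧ CommReduced u

variable {M}

theorem CanStart.exists_split {i : I} {u : List I} (h : M.CanStart i u) :
    ∃ v t, u = v ++ i :: t ∧ ∀ j ∈ v, M i j = 2 := by
  induction u with
  | nil => exact h.elim
  | cons j u ih =>
    rcases h with rfl | ⟨hj, h⟩
    · exact ⟨[], u, rfl, by simp⟩
    · obtain ⟨v, t, rfl, hv⟩ := ih h
      exact ⟨j :: v, t, rfl, by simpa [hj] using hv⟩

theorem exists_split_of_not_commReduced {u : List I} (h : ¬ M.CommReduced u) :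
    ∃ a i v t, u = a ++ i :: (v ++ i :: t) ∧ ∀ j ∈ v, M i j = 2 := by
  induction u with
  | nil => exact (h trivial).elim
  | cons j u ih =>
    by_cases hj : M.CanStart j u
    · obtain ⟨v, t, rfl, hv⟩ := hj.exists_split
      exact ⟨[], j, v, t, rfl, hv⟩
    · obtain ⟨a, i, v, t, rfl, hv⟩ := ih fun hu => h ⟨hj, hu⟩
      exact ⟨j :: a, i, v, t, rfl, hv⟩

theorem simple_commute {i j : I} (h : M i j = 2) :
    M.toCoxeterSystem.simple i * M.toCoxeterSystem.simple j =
      M.toCoxeterSystem.simple j * M.toCoxeterSystem.simple i := by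
  have h2 := M.toCoxeterSystem.simple_mul_simple_pow i j
  rw [h, pow_two] at h2
  rw [eq_inv_of_mul_eq_one_left h2, mul_inv_rev, M.toCoxeterSystem.inv_simple,
    M.toCoxeterSystem.inv_simple]

theorem simple_mul_wordProd {i : I} {v : List I} (hv : ∀ j ∈ v, M i j = 2) :
    M.toCoxeterSystem.simple i * M.toCoxeterSystem.wordProd v =
      M.toCoxeterSystem.wordProd v * M.toCoxeterSystem.simple i := by
  induction v with
  | nil => simp
  | cons j v ih =>
    rw [CoxeterSystem.wordProd_cons, ← mul_assoc, simple_commute (hv j (by simp)), mul_assoc,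
      ih fun l hl => hv l (by simp [hl]), mul_assoc]

theorem commReduced_of_isReduced {u : List I} (h : M.toCoxeterSystem.IsReduced u) :
    M.CommReduced u := by
  by_contra hu
  obtain ⟨a, i, v, t, rfl, hv⟩ := exists_split_of_not_commReduced hu
  have key : M.toCoxeterSystem.wordProd (a ++ i :: (v ++ i :: t)) =
      M.toCoxeterSystem.wordProd (a ++ (v ++ t)) := by
    simp only [CoxeterSystem.wordProd_append, CoxeterSystem.wordProd_cons]
    congr 1
    rw [← mul_assoc, simple_mul_wordProd hv, mul_assoc,
      M.toCoxeterSystem.simple_mul_simple_cancel_left]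
  have h1 := M.toCoxeterSystem.length_wordProd_le (a ++ (v ++ t))
  rw [← key, h.eq] at h1
  simp at h1

/-! ### The numbers game and the word problem -/

open Classical in
/-- The firing move at the node `i` in the numbers game of the matrix `M`. -/
noncomputable def fire (M : CoxeterMatrix I) (i : I) (p : I → ℤ) : I → ℤ :=
  -- With weight `2` on an infinite bond, firing at `i` preserves `p i + p j`; this drives the
  -- invariant of `position_sign`.
  fun j => if j = i then -p i else if M i j = 0 then p j + 2 * p i else p j

theorem fire_fire (i : I) (p : I → ℤ) : M.fire i (M.fire i p) = p := by
  funext j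
  by_cases hj : j = i
  · simp [fire, hj]
  · by_cases h0 : M i j = 0 <;> simp [fire, hj, h0]

theorem fire_comm {i j : I} (h : M i j = 2) (p : I → ℤ) :
    M.fire i (M.fire j p) = M.fire j (M.fire i p) := by
  have hij : i ≠ j := by
    rintro rfl
    simp at h
  have h' : M j i = 2 := by rw [M.symmetric, h]
  funext l
  by_cases hi : l = i
  · subst hi
    simp [fire, hij, h']
  · by_cases hj : l = j
    · subst hj
      simp [fire, hij.symm, h]
    · simp only [fire, hi, hj, hij, hij.symm, h, h', if_false]
      by_cases h1 : M i l = 0 <;> by_cases h2 : M j l = 0 <;> simp [h1, h2]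
      ring

/-- The firing move as a permutation. -/
noncomputable def firePerm (M : CoxeterMatrix I) (i : I) : Equiv.Perm (I → ℤ) :=
  ⟨M.fire i, M.fire i, fire_fire i, fire_fire i⟩

theorem IsRightAngled.isLiftable_firePerm (hM : M.IsRightAngled) :
    M.IsLiftable M.firePerm := by
  intro i j
  by_cases hij : i = j
  · subst hij
    ext1 p
    simpa [firePerm] using fire_fire i p
  · rcases hM i j hij with h | h
    · rw [h]
      ext1 p
      simp [pow_two, firePerm, fire_comm h, fire_fire]
    · rw [h, pow_zero]

/-- The position reached in the numbers game by firing the letters of a word from right to left,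
starting from the constant position `1`. -/
noncomputable def position (M : CoxeterMatrix I) : List I → I → ℤ
  | [] => fun _ => 1
  | i :: u => M.fire i (position M u)

theorem IsRightAngled.position_eq (hM : M.IsRightAngled) (u : List I) :
    M.position u = M.toCoxeterSystem.lift ⟨_, hM.isLiftable_firePerm⟩
      (M.toCoxeterSystem.wordProd u) (fun _ => 1) := by
  induction u with
  | nil => simp [position]
  | cons i u ih =>
    rw [CoxeterSystem.wordProd_cons, map_mul, CoxeterSystem.lift_apply_simple, position, ih]
    rfl

/-- The position depends only on the group element, so its signs make the possible first letters an
invariant of the element. The third clause carries the induction: after firing `l`, a neighbour has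
value `(p i + p l) + p l`, a sum of two positive numbers. -/
theorem IsRightAngled.position_sign (hM : M.IsRightAngled) {u : List I} (hu : M.CommReduced u) :
    (∀ i, M.CanStart i u → M.position u i < 0) ∧ (∀ i, ¬ M.CanStart i u → 0 < M.position u i) ∧
      ∀ i j, M i j = 0 → 0 < M.position u i + M.position u j := by
  induction u with
  | nil => exact ⟨fun i h => h.elim, fun i _ => by simp [position], by simp [position]⟩
  | cons l u ih =>
    classical
    obtain ⟨h1, h2, h3⟩ := ih hu.2
    have hl := h2 l hu.1
    have hpos : ∀ i, M.position (l :: u) i = if i = l then -M.position u l else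
        if M l i = 0 then M.position u i + 2 * M.position u l else M.position u i :=
      fun i => by simp [position, fire]
    refine ⟨fun i hi => ?_, fun i hi => ?_, fun i j hij => ?_⟩
    · rw [hpos]
      rcases hi with rfl | ⟨hi, hs⟩
      · simpa using hl
      · have hil : i ≠ l := by
          rintro rfl
          simp at hi
        have : M l i ≠ 0 := by rw [M.symmetric, hi]; simp
        simpa [hil, this] using h1 i hs
    · have hil : i ≠ l := fun h => hi (Or.inl h.symm)
      rw [hpos, if_neg hil]
      rcases hM l i (Ne.symm hil) with h | h
      · rw [if_neg (by simp [h])]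
        exact h2 i fun hs => hi (Or.inr ⟨by rw [M.symmetric, h], hs⟩)
      · rw [if_pos h]
        have := h3 l i h
        omega
    · rw [hpos, hpos]
      have h4 := h3 i j hij
      have hne : i ≠ j := by
        rintro rfl
        simp at hij
      by_cases hi : i = l
      · subst hi
        rw [if_pos rfl, if_neg hne.symm, if_pos hij]
        omega
      · rw [if_neg hi]
        by_cases hj : j = l
        · subst hj
          rw [if_pos rfl, if_pos (by rw [M.symmetric, hij])]
          omega
        · rw [if_neg hj]
          split_ifs <;> omega

/-- The last clause serves the induction: it ensures that `l :: v'` is still commutation-reduced. -/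
theorem CanStart.exists_tail {i : I} {v : List I} (h : M.CanStart i v) (hv : M.CommReduced v) :
    ∃ v', M.CommReduced v' ∧ v.length = v'.length + 1 ∧
      M.toCoxeterSystem.wordProd v =
        M.toCoxeterSystem.simple i * M.toCoxeterSystem.wordProd v' ∧
      ∀ j, M i j = 2 → M.CanStart j v' → M.CanStart j v := by
  induction v with
  | nil => exact h.elim
  | cons l v ih =>
    by_cases hli : l = i
    · subst hli
      exact ⟨v, hv.2, rfl, CoxeterSystem.wordProd_cons .., fun j hj hs =>
        Or.inr ⟨by rw [M.symmetric, hj], hs⟩⟩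
    · obtain ⟨hl, hs⟩ := h.resolve_left hli
      obtain ⟨v', h1, h2, h3, h4⟩ := ih hs hv.2
      refine ⟨l :: v', ⟨fun h => hv.1 (h4 l hl h), h1⟩, by simp [h2], ?_, ?_⟩
      · rw [CoxeterSystem.wordProd_cons, CoxeterSystem.wordProd_cons, h3, ← mul_assoc,
          ← mul_assoc, simple_commute hl]
      · rintro j hj (rfl | ⟨h5, h6⟩)
        · exact Or.inl rfl
        · exact Or.inr ⟨h5, h4 j hj h6⟩

/-- By the signs of the common position, the first letter of `u` can also start `v`; strip it from
both and induct. -/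
theorem IsRightAngled.length_eq (hM : M.IsRightAngled) {u v : List I} (hu : M.CommReduced u)
    (hv : M.CommReduced v)
    (h : M.toCoxeterSystem.wordProd u = M.toCoxeterSystem.wordProd v) :
    u.length = v.length := by
  induction u generalizing v with
  | nil =>
    cases v with
    | nil => rfl
    | cons j v =>
      have h1 := (hM.position_sign hv).1 j (Or.inl rfl)
      rw [hM.position_eq, ← h, ← hM.position_eq] at h1
      simp [position] at h1
  | cons i u ih =>
    have hs : M.CanStart i v := by
      by_contra hs
      have h1 := (hM.position_sign hv).2.1 i hs
      rw [hM.position_eq, ← h, ← hM.position_eq] at h1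
      exact (h1.trans ((hM.position_sign hu).1 i (Or.inl rfl))).false
    obtain ⟨v', h1, h2, h3, -⟩ := hs.exists_tail hv
    rw [h3, CoxeterSystem.wordProd_cons] at h
    rw [h2, ← ih hu.2 h1 (mul_left_cancel h), List.length_cons]

theorem IsRightAngled.isReduced (hM : M.IsRightAngled) {u : List I} (hu : M.CommReduced u) :
    M.toCoxeterSystem.IsReduced u := by
  obtain ⟨w, hw, h⟩ := M.toCoxeterSystem.exists_isReduced (M.toCoxeterSystem.wordProd u)
  rw [CoxeterSystem.IsReduced, h, hw.eq]
  exact (hM.length_eq hu (commReduced_of_isReduced hw) h).symm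

end CoxeterMatrix

/-! ### Moves and runs for a legal colouring -/

namespace ChamberSystem

variable {I C : Type*} {Δ : ChamberSystem I C}

theorem mem_residueOf_self (J : Set I) (c : C) : c ∈ Δ.residueOf J c :=
  ⟨[], by simp, rfl⟩

theorem mem_residueOf_singleton {i : I} {c d : C} :
    d ∈ Δ.residueOf {i} c ↔ Δ.equiv i c d := by
  constructor
  · rintro ⟨w, hw, h⟩
    induction w generalizing c with
    | nil =>
      cases h
      exact Setoid.refl' _ _
    | cons j w ih =>
      obtain ⟨e, -, he, h⟩ := h
      obtain rfl : j = i := hw j (by simp)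
      exact Setoid.trans' _ he (ih (fun l hl => hw l (by simp [hl])) h)
  · intro h
    by_cases hcd : c = d
    · exact hcd ▸ mem_residueOf_self _ _
    · exact ⟨[i], by simp, d, hcd, h, rfl⟩

variable (Δ) in
/-- The `J`-residue of a chamber. -/
def residueAt (J : Set I) (c : C) : Δ.Residue J := ⟨Δ.residueOf J c, c, rfl⟩

theorem Residue.exists_eq_residueAt {J : Set I} (R : Δ.Residue J) : ∃ c, R = Δ.residueAt J c := by
  obtain ⟨c, hc⟩ := R.2
  exact ⟨c, Subtype.ext hc⟩

namespace LegalColouring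

variable {X : I → Type*} (L : Δ.LegalColouring X)

/-- The chamber with `i`-colour `x` in the `i`-panel of `c`. -/
noncomputable def move (i : I) (x : X i) (c : C) : C :=
  ((L.panelEquiv (Δ.residueAt {i} c)).symm x).1

theorem equiv_move (i : I) (x : X i) (c : C) : Δ.equiv i c (L.move i x c) :=
  mem_residueOf_singleton.1 ((L.panelEquiv (Δ.residueAt {i} c)).symm x).2

@[simp]
theorem col_move_self (i : I) (x : X i) (c : C) : L.col (L.move i x c) i = x :=
  (L.panelEquiv (Δ.residueAt {i} c)).apply_symm_apply x

theorem col_eq_of_equiv {i j : I} (hj : j ≠ i) {c d : C} (h : Δ.equiv i c d) :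
    L.col c j = L.col d j :=
  L.constant i j hj (Δ.residueAt {i} c) c (mem_residueOf_self _ _) d (mem_residueOf_singleton.2 h)

theorem col_move_ne {i j : I} (hj : j ≠ i) (x : X i) (c : C) :
    L.col (L.move i x c) j = L.col c j :=
  (L.col_eq_of_equiv hj (L.equiv_move i x c)).symm

theorem eq_of_equiv_of_col_eq {i : I} {c d : C} (h : Δ.equiv i c d)
    (hcol : L.col c i = L.col d i) : c = d :=
  congrArg Subtype.val ((L.bijective i (Δ.residueAt {i} c)).1
    (a₁ := ⟨c, mem_residueOf_self _ _⟩) (a₂ := ⟨d, mem_residueOf_singleton.2 h⟩) hcol)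

theorem move_eq_of_equiv {i : I} {c d : C} (h : Δ.equiv i c d) : L.move i (L.col d i) c = d :=
  L.eq_of_equiv_of_col_eq (Setoid.trans' _ (Setoid.symm' _ (L.equiv_move i _ c)) h) (by simp)

theorem move_eq_self {i : I} {x : X i} {c : C} (h : L.col c i = x) : L.move i x c = c := by
  subst h
  exact L.move_eq_of_equiv (Setoid.refl' _ c)

@[simp]
theorem move_move (i : I) (x y : X i) (c : C) :
    L.move i x (L.move i y c) = L.move i x c :=
  L.eq_of_equiv_of_col_eq
    (Setoid.trans' _ (Setoid.symm' _ (L.equiv_move i x _))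
      (Setoid.trans' _ (Setoid.symm' _ (L.equiv_move i y c)) (L.equiv_move i x c))) (by simp)

/-- The chamber reached from `c` by a sequence of moves. -/
noncomputable def run : List (Σ i, X i) → C → C
  | [], c => c
  | a :: w, c => run w (L.move a.1 a.2 c)

@[simp]
theorem run_nil (c : C) : L.run [] c = c := rfl

@[simp]
theorem run_cons (a : Σ i, X i) (w : List (Σ i, X i)) (c : C) :
    L.run (a :: w) c = L.run w (L.move a.1 a.2 c) := rfl

@[simp]
theorem run_append (v w : List (Σ i, X i)) (c : C) :
    L.run (v ++ w) c = L.run w (L.run v c) := by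
  induction v generalizing c with
  | nil => rfl
  | cons a v ih => exact ih _

theorem exists_run_of_isGallery {w : List I} {c d : C} (h : Δ.IsGallery w c d) :
    ∃ u : List (Σ i, X i), u.map Sigma.fst = w ∧ L.run u c = d := by
  induction w generalizing c with
  | nil => exact ⟨[], rfl, h⟩
  | cons i w ih =>
    obtain ⟨e, -, he, h⟩ := h
    obtain ⟨u, hu, h⟩ := ih h
    refine ⟨⟨i, L.col e i⟩ :: u, by simp [hu], ?_⟩
    rw [run_cons, L.move_eq_of_equiv he, h]

/-- Every move of the sequence, starting at `c`, changes the chamber. -/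
def IsStrict : List (Σ i, X i) → C → Prop
  | [], _ => True
  | a :: w, c => L.col c a.1 ≠ a.2 ∧ IsStrict w (L.move a.1 a.2 c)

theorem exists_split_of_not_isStrict {w : List (Σ i, X i)} {c : C} (h : ¬ L.IsStrict w c) :
    ∃ u a t, w = u ++ a :: t ∧ L.col (L.run u c) a.1 = a.2 := by
  induction w generalizing c with
  | nil => exact (h trivial).elim
  | cons a w ih =>
    by_cases ha : L.col c a.1 = a.2
    · exact ⟨[], a, w, rfl, ha⟩
    · obtain ⟨u, b, t, rfl, hb⟩ := ih fun hw => h ⟨ha, hw⟩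
      exact ⟨a :: u, b, t, rfl, hb⟩

theorem IsStrict.isGallery {L : Δ.LegalColouring X} {w : List (Σ i, X i)} {c : C}
    (h : L.IsStrict w c) : Δ.IsGallery (w.map Sigma.fst) c (L.run w c) := by
  induction w generalizing c with
  | nil => rfl
  | cons a w ih =>
    refine ⟨L.move a.1 a.2 c, fun hc => h.1 ?_, L.equiv_move _ _ _, ih h.2⟩
    rw [hc, col_move_self]

end LegalColouring

/-! ### Closed runs and automorphisms that permute colours -/

namespace LegalColouring

variable {M : CoxeterMatrix I} {X : I → Type*} (L : Δ.LegalColouring X)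

theorem exists_run (hΔ : Δ.IsBuilding M) (c d : C) : ∃ w, L.run w c = d := by
  obtain ⟨δ, hδ⟩ := hΔ.exists_dist
  obtain ⟨w, hw, h⟩ := M.toCoxeterSystem.exists_isReduced (δ c d)
  obtain ⟨u, -, hu⟩ := L.exists_run_of_isGallery ((hδ w hw c d).1 h)
  exact ⟨u, hu⟩

theorem induction_move (hΔ : Δ.IsBuilding M) {p : C → Prop} (c : C) (hc : p c)
    (h : ∀ d i x, p d → p (L.move i x d)) (d : C) : p d := by
  obtain ⟨w, rfl⟩ := L.exists_run hΔ c d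
  induction w generalizing c with
  | nil => exact hc
  | cons a w ih => exact ih _ (h _ _ _ hc)

/-- The Weyl distance is the same for the types `ij` and `ji`, so a gallery of the other type exists
too; colours identify its middle chamber. Stationary moves are treated separately because galleries
do not allow them. -/
theorem move_comm (hM : M.IsRightAngled) (hΔ : Δ.IsBuilding M) {i j : I} (hij : M i j = 2)
    (x : X i) (y : X j) (c : C) :
    L.move i x (L.move j y c) = L.move j y (L.move i x c) := by
  have hne : i ≠ j := by
    rintro rfl
    simp at hij
  by_cases hx : L.col c i = x
  · rw [L.move_eq_self hx, L.move_eq_self (by rw [L.col_move_ne hne, hx])]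
  by_cases hy : L.col c j = y
  · rw [L.move_eq_self hy, L.move_eq_self (x := y) (by rw [L.col_move_ne hne.symm, hy])]
  have hred : ∀ {a b : I}, a ≠ b → M.toCoxeterSystem.IsReduced [a, b] := fun {a b} h =>
    hM.isReduced ⟨fun hs => hs.elim (fun hs => h hs.symm) fun hs => hs.2.elim,
      fun hs => hs.elim, trivial⟩
  obtain ⟨δ, hδ⟩ := hΔ.exists_dist
  have hg : Δ.IsGallery [j, i] c (L.move i x (L.move j y c)) :=
    IsStrict.isGallery (L := L) (w := [⟨j, y⟩, ⟨i, x⟩])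
      ⟨hy, by simpa [L.col_move_ne hne] using hx, trivial⟩
  have h := (hδ _ (hred hne.symm) _ _).2 hg
  have hw : M.toCoxeterSystem.wordProd [j, i] = M.toCoxeterSystem.wordProd [i, j] := by
    simpa [CoxeterSystem.wordProd_cons] using (CoxeterMatrix.simple_commute hij).symm
  rw [hw] at h
  obtain ⟨e, -, he, e', -, he', rfl⟩ := (hδ _ (hred hne) _ _).1 h
  have h1 : L.col e i = x := by
    rw [L.col_eq_of_equiv hne he', col_move_self]
  rw [← L.move_eq_of_equiv he', ← L.move_eq_of_equiv he, h1, L.col_move_ne hne.symm,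
    col_move_self]

theorem run_move_comm (hM : M.IsRightAngled) (hΔ : Δ.IsBuilding M) {i : I}
    {v : List (Σ i, X i)} (hv : ∀ a ∈ v, M i a.1 = 2) (x : X i) (c : C) :
    L.run v (L.move i x c) = L.move i x (L.run v c) := by
  induction v generalizing c with
  | nil => rfl
  | cons a v ih =>
    rw [run_cons, ← L.move_comm hM hΔ (hv a (by simp)), ih fun b hb => hv b (by simp [hb]),
      run_cons]

/-- A run without stationary moves is a gallery. If its type were reduced, it would represent `δ c c
= 1` and so have length zero. -/
theorem exists_split_of_run_eq (hM : M.IsRightAngled) (hΔ : Δ.IsBuilding M)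
    {w : List (Σ i, X i)} {c : C} (hw : w ≠ []) (h : L.run w c = c) :
    (∃ u a t, w = u ++ a :: t ∧ L.col (L.run u c) a.1 = a.2) ∨
      ∃ u i x v z t, w = u ++ ⟨i, x⟩ :: (v ++ ⟨i, z⟩ :: t) ∧ ∀ a ∈ v, M i a.1 = 2 := by
  by_cases hs : L.IsStrict w c
  · right
    obtain ⟨δ, hδ⟩ := hΔ.exists_dist
    have hred : ¬ M.CommReduced (w.map Sigma.fst) := by
      intro hr
      have h1 := (hδ _ (hM.isReduced hr) _ _).2 hs.isGallery
      rw [h, (hδ [] (hM.isReduced trivial) c c).2 rfl] at h1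
      have h2 := (hM.isReduced hr).eq
      rw [← h1] at h2
      simp at h2
      exact hw (List.eq_nil_of_length_eq_zero h2.symm)
    obtain ⟨a, i, v, t, hsplit, hv⟩ := CoxeterMatrix.exists_split_of_not_commReduced hred
    obtain ⟨a', r, rfl, -, hr⟩ := List.map_eq_append_iff.1 hsplit
    obtain ⟨⟨i', x⟩, r, rfl, hi, hr⟩ := List.map_eq_cons_iff.1 hr
    obtain ⟨v', r', rfl, rfl, hr'⟩ := List.map_eq_append_iff.1 hr
    obtain ⟨⟨i'', z⟩, t', rfl, hi', -⟩ := List.map_eq_cons_iff.1 hr'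
    obtain rfl : i' = i := hi
    obtain rfl : i'' = i' := hi'
    exact ⟨a', i'', x, v', z, t', rfl, fun b hb => hv _ (List.mem_map_of_mem hb)⟩
  · exact Or.inl (L.exists_split_of_not_isStrict hs)

/-- Recolour the entries of a sequence of moves. -/
def mapWord (f : ∀ i, Equiv.Perm (X i)) (w : List (Σ i, X i)) : List (Σ i, X i) :=
  w.map fun a => ⟨a.1, f a.1 a.2⟩

theorem col_move_eq_apply {f : ∀ i, Equiv.Perm (X i)} {c d : C}
    (h : ∀ i, L.col d i = f i (L.col c i)) (i : I) (x : X i) (j : I) :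
    L.col (L.move i (f i x) d) j = f j (L.col (L.move i x c) j) := by
  by_cases hj : j = i
  · subst hj
    simp
  · rw [L.col_move_ne hj, L.col_move_ne hj, h]

theorem col_run_mapWord {f : ∀ i, Equiv.Perm (X i)} {c d : C}
    (h : ∀ i, L.col d i = f i (L.col c i)) (w : List (Σ i, X i)) (i : I) :
    L.col (L.run (mapWord f w) d) i = f i (L.col (L.run w c) i) := by
  induction w generalizing c d with
  | nil => exact h i
  | cons a w ih => exact ih (L.col_move_eq_apply h a.1 a.2)

/-- Each shortening of the closed run is also one of the recoloured run: stationary moves stay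
stationary because colours correspond under `f`, and merging depends only on types. -/
theorem run_mapWord_eq_self (hM : M.IsRightAngled) (hΔ : Δ.IsBuilding M)
    {f : ∀ i, Equiv.Perm (X i)} {c d : C} (hcd : ∀ i, L.col d i = f i (L.col c i))
    {w : List (Σ i, X i)} (h : L.run w c = c) : L.run (mapWord f w) d = d := by
  induction hn : w.length using Nat.strong_induction_on generalizing w with
  | _ n ih =>
    subst hn
    by_cases hw : w = []
    · subst hw
      rfl
    rcases L.exists_split_of_run_eq hM hΔ hw h with
      ⟨u, a, t, rfl, ha⟩ | ⟨u, i, x, v, z, t, rfl, hv⟩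
    · have h1 := ih (u ++ t).length (by simp) (w := u ++ t)
        (by simpa [L.move_eq_self ha] using h) rfl
      have h2 := L.col_run_mapWord hcd u a.1
      rw [ha] at h2
      simp only [mapWord, List.map_append, List.map_cons, run_append, run_cons] at h1 h2 ⊢
      rwa [L.move_eq_self h2]
    · have h1 := ih (u ++ (v ++ ⟨i, z⟩ :: t)).length (by simp) (w := u ++ (v ++ ⟨i, z⟩ :: t))
        (by simpa [L.run_move_comm hM hΔ hv] using h) rfl
      have hv' : ∀ a ∈ mapWord f v, M i a.1 = 2 := by
        intro a ha
        obtain ⟨b, hb, rfl⟩ := List.mem_map.1 ha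
        exact hv b hb
      have h3 := fun e => L.run_move_comm hM hΔ hv' (f i x) e
      simp only [mapWord, List.map_append, List.map_cons, run_append, run_cons] at h1 h3 ⊢
      simpa [h3] using h1

/-- Reduces the comparison of two runs with a common end to the case of a closed run. -/
theorem exists_reverse (f : ∀ i, Equiv.Perm (X i)) {c d : C}
    (hcd : ∀ i, L.col d i = f i (L.col c i)) (w : List (Σ i, X i)) :
    ∃ r, L.run r (L.run w c) = c ∧ L.run (mapWord f r) (L.run (mapWord f w) d) = d := by
  induction w generalizing c d with
  | nil => exact ⟨[], rfl, rfl⟩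
  | cons a w ih =>
    obtain ⟨r, h1, h2⟩ := ih (L.col_move_eq_apply hcd a.1 a.2)
    refine ⟨r ++ [⟨a.1, L.col c a.1⟩], ?_, ?_⟩
    · simp [h1, L.move_eq_self]
    · simp only [mapWord, List.map_append, List.map_cons, run_append, run_cons] at h2 ⊢
      simp [h2, L.move_eq_self, hcd]

theorem run_mapWord_eq (hM : M.IsRightAngled) (hΔ : Δ.IsBuilding M)
    {f : ∀ i, Equiv.Perm (X i)} {c d : C} (hcd : ∀ i, L.col d i = f i (L.col c i))
    {v w : List (Σ i, X i)} (h : L.run v c = L.run w c) :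
    L.run (mapWord f v) d = L.run (mapWord f w) d := by
  obtain ⟨r, h1, h2⟩ := L.exists_reverse f hcd w
  have h3 := L.run_mapWord_eq_self hM hΔ (L.col_run_mapWord hcd w) (w := r ++ v)
    (by rw [run_append, h1, h])
  simp only [mapWord, List.map_append, run_append] at h2 h3 ⊢
  rwa [h2] at h3

theorem exists_recolouring (hM : M.IsRightAngled) (hΔ : Δ.IsBuilding M)
    (f : ∀ i, Equiv.Perm (X i)) {c d : C} (hcd : ∀ i, L.col d i = f i (L.col c i)) :
    ∃ g : C → C, g c = d ∧ ∀ i x e, g (L.move i x e) = L.move i (f i x) (g e) := by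
  -- Send the end of a run from `c` to the end of the recoloured run from `d`; `key` says that the
  -- choice of run is irrelevant.
  choose w hw using L.exists_run hΔ c
  have key : ∀ v, L.run (mapWord f (w (L.run v c))) d = L.run (mapWord f v) d := fun v =>
    L.run_mapWord_eq hM hΔ hcd (hw _)
  refine ⟨fun e => L.run (mapWord f (w e)) d, by simpa [mapWord] using key [], fun i x e => ?_⟩
  have := key (w e ++ [⟨i, x⟩])
  simpa [hw, mapWord] using this

theorem exists_perm_recolouring (hM : M.IsRightAngled) (hΔ : Δ.IsBuilding M)
    (f : ∀ i, Equiv.Perm (X i)) {c d : C} (hcd : ∀ i, L.col d i = f i (L.col c i)) :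
    ∃ g : Equiv.Perm C, g c = d ∧ ∀ i x e, g (L.move i x e) = L.move i (f i x) (g e) := by
  obtain ⟨g, hg, hg'⟩ := L.exists_recolouring hM hΔ f hcd
  obtain ⟨h, hh, hh'⟩ := L.exists_recolouring hM hΔ (fun i => (f i)⁻¹) (c := d) (d := c)
    (fun i => by simp [hcd])
  refine ⟨⟨g, h, fun e => ?_, fun e => ?_⟩, hg, hg'⟩
  · refine L.induction_move hΔ (p := fun e => h (g e) = e) c (by rw [hg, hh]) ?_ e
    intro e i x he
    rw [hg', hh', he]
    simp
  · refine L.induction_move hΔ (p := fun e => g (h e) = e) d (by rw [hh, hg]) ?_ e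
    intro e i x he
    rw [hh', hg', he]
    simp

end LegalColouring

end ChamberSystem

namespace ChamberSystem
namespace LegalColouring

variable {I C : Type*} {Δ : ChamberSystem I C}
variable {M : CoxeterMatrix I} {X : I → Type*} (L : Δ.LegalColouring X)

/-! ### Elements of the universal group -/

/-- With its converse `exists_universalGroup_eq`, this replaces local actions at panels by a rule
for moves, the form used from here on. -/
theorem exists_apply_move {F : ∀ i, Subgroup (Equiv.Perm (X i))} (g : L.universalGroup F) (i : I)
    (c : C) : ∃ f ∈ F i, ∀ x, g.1.1 (L.move i x c) = L.move i (f x) (g.1.1 c) := by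
  refine ⟨_, g.2 i (Δ.residueAt {i} c), fun x => ?_⟩
  have h := L.localAction_col g.1 (Δ.residueAt {i} c) (L.move i x c)
    (mem_residueOf_singleton.2 (L.equiv_move i x c))
  rw [col_move_self] at h
  rw [h]
  exact (L.move_eq_of_equiv ((g.1.2 i _ _).2 (L.equiv_move i x c))).symm

theorem exists_universalGroup_eq {F : ∀ i, Subgroup (Equiv.Perm (X i))} (g : Equiv.Perm C)
    (h : ∀ i c, ∃ f ∈ F i, ∀ x, g (L.move i x c) = L.move i (f x) (g c)) :
    ∃ u : L.universalGroup F, u.1.1 = g := by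
  have hg : g ∈ Δ.Aut := by
    intro i c d
    obtain ⟨f, -, hf⟩ := h i c
    constructor
    · intro hcd
      have h1 := L.move_eq_of_equiv hcd
      rw [← f.apply_symm_apply (L.col (g d) i), ← hf] at h1
      rw [← g.injective h1]
      exact L.equiv_move _ _ _
    · intro hcd
      rw [← L.move_eq_of_equiv hcd, hf]
      exact L.equiv_move _ _ _
  refine ⟨⟨⟨g, hg⟩, fun i P => ?_⟩, rfl⟩
  obtain ⟨c, rfl⟩ := P.exists_eq_residueAt
  obtain ⟨f, hfF, hf⟩ := h i c
  convert hfF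
  ext x
  have h1 := L.localAction_col ⟨g, hg⟩ (Δ.residueAt {i} c) (L.move i x c)
    (mem_residueOf_singleton.2 (L.equiv_move i x c))
  rw [col_move_self] at h1
  rw [h1, hf, col_move_self]

theorem exists_extension (hM : M.IsRightAngled) (hΔ : Δ.IsBuilding M)
    (F : ∀ i, Subgroup (Equiv.Perm (X i))) {i : I} {f : Equiv.Perm (X i)} (hf : f ∈ F i) (c : C) :
    ∃ g : L.universalGroup F, g.1.1 c = L.move i (f (L.col c i)) c ∧
      (∀ x e, g.1.1 (L.move i x e) = L.move i (f x) (g.1.1 e)) ∧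
      ∀ j, j ≠ i → ∀ x e, g.1.1 (L.move j x e) = L.move j x (g.1.1 e) := by
  classical
  obtain ⟨g, h1, h2⟩ := L.exists_perm_recolouring hM hΔ
    (Function.update (fun j => (1 : Equiv.Perm (X j))) i f) (c := c)
    (d := L.move i (f (L.col c i)) c) (by
      intro j
      by_cases hj : j = i
      · subst hj
        simp
      · simp [hj, L.col_move_ne])
  have h3 : ∀ x e, g (L.move i x e) = L.move i (f x) (g e) := fun x e => by simp [h2]
  have h4 : ∀ j, j ≠ i → ∀ x e, g (L.move j x e) = L.move j x (g e) :=
    fun j hj x e => by simp [h2, hj]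
  obtain ⟨u, rfl⟩ := L.exists_universalGroup_eq (F := F) g (by
    intro j e
    by_cases hj : j = i
    · subst hj
      exact ⟨f, hf, fun x => h3 x e⟩
    · exact ⟨1, one_mem _, fun x => h4 j hj x e⟩)
  exact ⟨u, h1, h3, h4⟩

/-! ### Tree-walls and wings -/

/-- The tree-wall of type `k` through `b`: the chambers reachable from `b` by moves whose types are
equal to `k` or commute with `k`. -/
inductive Wall (M : CoxeterMatrix I) (L : Δ.LegalColouring X) (k : I) (b : C) : C → Prop
  | base : Wall M L k b b
  | move_self (x : X k) (c : C) : Wall M L k b c → Wall M L k b (L.move k x c)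
  | move_comm (j : I) (hj : M k j = 2) (x : X j) (c : C) :
      Wall M L k b c → Wall M L k b (L.move j x c)

variable {L} {k : I} {b : C}

theorem wall_move_iff {j : I} (hj : j = k ∨ M k j = 2) (x : X j) (c : C) :
    Wall M L k b (L.move j x c) ↔ Wall M L k b c := by
  have key : ∀ (x : X j) (c : C), Wall M L k b c → Wall M L k b (L.move j x c) := by
    intro x c h
    rcases hj with rfl | hj
    · exact h.move_self x
    · exact h.move_comm j hj x
  refine ⟨fun h => ?_, key x c⟩
  have := key (L.col c j) _ h
  rwa [move_move, L.move_eq_self rfl] at this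

/-- A type `i` with `m i k = ∞` is neither `k` nor commutes with `k`, so no move within the wall
alters colour `i`. This is what tells tree-walls apart. -/
theorem Wall.col_eq {c : C} (h : Wall M L k b c) {i : I} (hi : M i k = 0) :
    L.col c i = L.col b i := by
  induction h with
  | base => rfl
  | move_self x c _ ih =>
    rw [L.col_move_ne _ x c, ih]
    rintro rfl
    simp at hi
  | move_comm j hj x c _ ih =>
    rw [L.col_move_ne _ x c, ih]
    rintro rfl
    rw [M.symmetric, hi] at hj
    simp at hj

theorem wall_run_iff {v : List (Σ i, X i)} (hv : ∀ a ∈ v, M k a.1 = 2) (c : C) :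
    Wall M L k b (L.run v c) ↔ Wall M L k b c := by
  induction v generalizing c with
  | nil => rfl
  | cons a v ih =>
    rw [run_cons, ih fun a' h => hv a' (by simp [h]), wall_move_iff (Or.inr (hv a (by simp)))]

/-- All `k`-moves commute to the front and merge into one. -/
theorem Wall.exists_run_eq (hM : M.IsRightAngled) (hΔ : Δ.IsBuilding M) {c : C}
    (h : Wall M L k b c) :
    ∃ v : List (Σ i, X i), (∀ a ∈ v, M k a.1 = 2) ∧ L.run v (L.move k (L.col c k) b) = c := by
  induction h with
  | base => exact ⟨[], by simp, L.move_eq_self rfl⟩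
  | move_self x c _ ih =>
    obtain ⟨v, hv, h⟩ := ih
    refine ⟨v, hv, ?_⟩
    rw [L.run_move_comm hM hΔ hv] at h ⊢
    rw [← h, move_move, col_move_self]
  | move_comm j hj x c _ ih =>
    obtain ⟨v, hv, h⟩ := ih
    have hjk : k ≠ j := by
      rintro rfl
      simp at hj
    refine ⟨v ++ [⟨j, x⟩], by simpa [or_imp, forall_and, hj] using hv, ?_⟩
    rw [run_append, L.col_move_ne hjk, h]
    rfl

variable (M L k b) in
/-- No move of the sequence, starting at `c`, is a move of type `k` inside the tree-wall. -/
def Avoids : List (Σ i, X i) → C → Prop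
  | [], _ => True
  | a :: w, c => (a.1 = k → ¬ Wall M L k b c) ∧ Avoids w (L.move a.1 a.2 c)

theorem avoids_append {v w : List (Σ i, X i)} {c : C} :
    Avoids M L k b (v ++ w) c ↔ Avoids M L k b v c ∧ Avoids M L k b w (L.run v c) := by
  induction v generalizing c with
  | nil => simp [Avoids]
  | cons a v ih => simp [Avoids, ih, and_assoc]

theorem avoids_of_comm {v : List (Σ i, X i)} (hv : ∀ a ∈ v, M k a.1 = 2) (c : C) :
    Avoids M L k b v c := by
  induction v generalizing c with
  | nil => trivial
  | cons a v ih =>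
    refine ⟨fun h => ?_, ih (fun a' h => hv a' (by simp [h])) _⟩
    have := hv a (by simp)
    simp [h] at this

theorem Avoids.of_move (hM : M.IsRightAngled) (hΔ : Δ.IsBuilding M) {i : I} {x : X i}
    {v : List (Σ i, X i)} (hv : ∀ a ∈ v, M i a.1 = 2) {c : C}
    (h : Avoids M L k b v (L.move i x c)) : Avoids M L k b v c := by
  induction v generalizing c with
  | nil => trivial
  | cons a v ih =>
    have ha := hv a (by simp)
    refine ⟨fun hk hc => h.1 hk ((wall_move_iff (Or.inr ?_) _ _).2 hc),
      ih (fun a' h => hv a' (by simp [h])) ?_⟩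
    · rw [M.symmetric, ← hk, ha]
    · rw [L.move_comm hM hΔ ha]
      exact h.2

/-- Wings are well defined because of this: a run that never crosses the wall cannot end at another
chamber of its initial `k`-panel. Close the run by a `k`-move back to `c` and shorten. -/
theorem Avoids.eq_col_of_run_eq (hM : M.IsRightAngled) (hΔ : Δ.IsBuilding M)
    {w : List (Σ i, X i)} {c : C} (hw : Avoids M L k b w c) (hc : Wall M L k b c) {y : X k}
    (h : L.run w c = L.move k y c) : y = L.col c k := by
  induction hn : w.length using Nat.strong_induction_on generalizing w with
  | _ n ih =>
    subst hn
    rcases L.exists_split_of_run_eq hM hΔ (w := w ++ [⟨k, L.col c k⟩]) (by simp)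
      (c := c) (by simp [h, L.move_eq_self]) with ⟨u, a, t, hs, ha⟩ | ⟨u, i, x, v, z, t, hs, hv⟩
    · rcases List.eq_nil_or_concat t with rfl | ⟨t, l, rfl⟩
      · obtain ⟨rfl, hl⟩ := List.append_inj' hs rfl
        obtain rfl := List.singleton_injective hl
        rw [h, col_move_self] at ha
        exact ha
      · rw [List.concat_eq_append, ← List.cons_append, ← List.append_assoc] at hs
        obtain ⟨rfl, -⟩ := List.append_inj' hs rfl
        have ha' := L.move_eq_self ha
        rw [avoids_append, Avoids, ha'] at hw
        exact ih (u ++ t).length (by simp) (w := u ++ t) (avoids_append.2 ⟨hw.1, hw.2.2⟩)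
          (by simpa [ha'] using h) rfl
    -- If `t` is empty, the closing move merges with an earlier `k`-move across moves commuting with
    -- `k`. That earlier move then lies in the wall, which `hw` forbids.
    · rcases List.eq_nil_or_concat t with rfl | ⟨t, l, rfl⟩
      · rw [← List.cons_append, ← List.append_assoc] at hs
        obtain ⟨rfl, hl⟩ := List.append_inj' hs rfl
        have hl := List.singleton_injective hl
        obtain rfl : k = i := congrArg Sigma.fst hl
        have h1 := (avoids_append.1 hw).2.1 rfl
        have h2 : Wall M L k b (L.run (u ++ ⟨k, x⟩ :: v) c) := by
          rw [h, wall_move_iff (Or.inl rfl)]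
          exact hc
        rw [run_append, run_cons, wall_run_iff hv, wall_move_iff (Or.inl rfl)] at h2
        exact (h1 h2).elim
      · have hs' : w ++ [⟨k, L.col c k⟩] = (u ++ ⟨i, x⟩ :: (v ++ ⟨i, z⟩ :: t)) ++ [l] := by
          rw [hs]
          simp
        obtain ⟨rfl, -⟩ := List.append_inj' hs' rfl
        refine ih (u ++ (v ++ ⟨i, z⟩ :: t)).length (by simp) (w := u ++ (v ++ ⟨i, z⟩ :: t)) ?_
          (by simpa [L.run_move_comm hM hΔ hv] using h) rfl
        simp only [avoids_append, Avoids, L.run_move_comm hM hΔ hv, move_move] at hw ⊢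
        refine ⟨hw.1, hw.2.2.1.of_move hM hΔ hv, fun hi hwall => hw.2.2.2.1 hi ?_, hw.2.2.2.2⟩
        exact (wall_move_iff (Or.inl hi) _ _).2 hwall

theorem Wall.exists_run_of_col_eq (hM : M.IsRightAngled) (hΔ : Δ.IsBuilding M) {c d : C}
    (hc : Wall M L k b c) (hd : Wall M L k b d) (h : L.col c k = L.col d k) :
    ∃ v : List (Σ i, X i), (∀ a ∈ v, M k a.1 = 2) ∧ L.run v c = d := by
  obtain ⟨v, hv, hv'⟩ := hc.exists_run_eq hM hΔ
  obtain ⟨w, hw, hw'⟩ := hd.exists_run_eq hM hΔ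
  rw [← h] at hw'
  obtain ⟨r, hr, hr'⟩ : ∃ r : List (Σ i, X i), (∀ a ∈ r, M k a.1 = 2) ∧
      L.run r c = L.move k (L.col c k) b := by
    generalize L.col c k = y at hv'
    clear hw' hw h
    induction v using List.reverseRecOn generalizing c with
    | nil => exact ⟨[], by simp, hv'.symm⟩
    | append_singleton v a ih =>
      rw [run_append, run_cons, run_nil] at hv'
      obtain ⟨r, hr, h⟩ := ih (c := L.run v (L.move k y b))
        ((wall_move_iff (Or.inr (hv a (by simp))) a.2 _).1 (hv' ▸ hc))
        (fun a' h => hv a' (by simp [h])) rfl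
      refine ⟨⟨a.1, L.col (L.run v (L.move k y b)) a.1⟩ :: r,
        by simpa [hv a (by simp)] using hr, ?_⟩
      rw [run_cons, ← hv', move_move, L.move_eq_self rfl, h]
  refine ⟨r ++ w, by simpa [or_imp, forall_and] using ⟨hr, hw⟩, ?_⟩
  rw [run_append, hr', hw']

theorem Avoids.exists_reverse {w : List (Σ i, X i)} {c : C} (h : Avoids M L k b w c) :
    ∃ r, Avoids M L k b r (L.run w c) ∧ L.run r (L.run w c) = c := by
  induction w generalizing c with
  | nil => exact ⟨[], trivial, rfl⟩
  | cons a w ih =>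
    obtain ⟨r, h1, h2⟩ := ih h.2
    refine ⟨r ++ [⟨a.1, L.col c a.1⟩], ?_, by simp [h2, L.move_eq_self]⟩
    rw [avoids_append]
    refine ⟨h1, fun ha => ?_, trivial⟩
    rw [run_cons, h2, wall_move_iff (Or.inl ha)]
    exact h.1 ha

variable (L k b) in
/-- The colour of the projection to a `k`-panel, depending only on the tree-wall of the panel. -/
theorem exists_wing (hM : M.IsRightAngled) (hΔ : Δ.IsBuilding M) :
    ∃ π : C → X k, (∀ c, Wall M L k b c → π c = L.col c k) ∧
      ∀ c i x, (i = k → ¬ Wall M L k b c) → π (L.move i x c) = π c := by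
  have ex : ∀ c, ∃ w, Avoids M L k b w c ∧ Wall M L k b (L.run w c) := by
    refine L.induction_move hΔ b ⟨[], trivial, Wall.base⟩ fun d i x ⟨w, h1, h2⟩ => ?_
    by_cases hd : i = k ∧ Wall M L k b d
    · exact ⟨[], trivial, (wall_move_iff (Or.inl hd.1) _ _).2 hd.2⟩
    · refine ⟨⟨i, L.col d i⟩ :: w, ⟨fun hi => ?_, ?_⟩, ?_⟩
      · rw [wall_move_iff (Or.inl hi)]
        exact fun h => hd ⟨hi, h⟩
      · simpa [L.move_eq_self] using h1
      · simpa [L.move_eq_self] using h2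
  -- Go back along `v`, forward along `w`, then within the wall to the `k`-panel where `v` ended;
  -- this composite avoids the wall's `k`-moves.
  have uniq : ∀ c v w, Avoids M L k b v c → Avoids M L k b w c → Wall M L k b (L.run v c) →
      Wall M L k b (L.run w c) → L.col (L.run v c) k = L.col (L.run w c) k := by
    intro c v w hv hw hv' hw'
    obtain ⟨r, hr, hr'⟩ := hv.exists_reverse
    obtain ⟨u, hu, hu'⟩ := hw'.exists_run_of_col_eq hM hΔ
      (hv'.move_self (L.col (L.run w c) k)) (by simp)
    refine (Avoids.eq_col_of_run_eq hM hΔ (w := r ++ (w ++ u)) (c := L.run v c) ?_ hv' ?_).symm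
    · rw [avoids_append, avoids_append, hr']
      exact ⟨hr, hw, avoids_of_comm hu _⟩
    · rw [run_append, run_append, hr', hu']
  choose w h1 h2 using ex
  refine ⟨fun c => L.col (L.run (w c) c) k, fun c hc => ?_, fun c i x hi => ?_⟩
  · exact uniq c (w c) [] (h1 c) trivial (h2 c) hc
  · exact uniq c (⟨i, x⟩ :: w (L.move i x c)) (w c) ⟨hi, h1 _⟩ (h1 c) (h2 _) (h2 c)

theorem Wall.apply {f : ∀ i, Equiv.Perm (X i)} {g : Equiv.Perm C} (hb : g b = b)
    (hg : ∀ i x e, g (L.move i x e) = L.move i (f i x) (g e)) {c : C} (h : Wall M L k b c) :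
    Wall M L k b (g c) := by
  induction h with
  | base =>
    rw [hb]
    exact Wall.base
  | move_self x c _ ih => exact hg k x c ▸ ih.move_self _
  | move_comm j hj x c _ ih => exact hg j x c ▸ ih.move_comm j hj _

theorem wall_apply_iff {f : ∀ i, Equiv.Perm (X i)} {g : Equiv.Perm C} (hb : g b = b)
    (hg : ∀ i x e, g (L.move i x e) = L.move i (f i x) (g e)) {c : C} :
    Wall M L k b (g c) ↔ Wall M L k b c := by
  refine ⟨fun h => ?_, Wall.apply hb hg⟩
  have := Wall.apply (g := g.symm) (f := fun i => (f i).symm) (by rw [Equiv.symm_apply_eq, hb])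
    (fun i x e => by rw [Equiv.symm_apply_eq, hg]; simp) h
  simpa using this

/-- A permutation `f` fixing the colour `x` extends from a tree-wall of type `k` to an element of
the universal group fixing the wing of colour `x`. -/
theorem exists_wing_extension (hM : M.IsRightAngled) (hΔ : Δ.IsBuilding M)
    (F : ∀ i, Subgroup (Equiv.Perm (X i))) {f : Equiv.Perm (X k)} (hf : f ∈ F k)
    (hfb : f (L.col b k) = L.col b k) {π : C → X k}
    (hπ : ∀ c, Wall M L k b c → π c = L.col c k)
    (hπ' : ∀ c i x, (i = k → ¬ Wall M L k b c) → π (L.move i x c) = π c) :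
    ∃ g : L.universalGroup F, (∀ c, π c = L.col b k → g.1.1 c = c) ∧
      ∀ c, Wall M L k b c → g.1.1 c = L.move k (f (L.col c k)) c := by
  classical
  obtain ⟨g, hgb, hg⟩ := L.exists_perm_recolouring hM hΔ
    (Function.update (fun j => (1 : Equiv.Perm (X j))) k f) (c := b) (d := b) (by
      intro j
      by_cases hj : j = k
      · subst hj
        simp [hfb]
      · simp [hj])
  have hg1 : ∀ x e, g (L.move k x e) = L.move k (f x) (g e) := fun x e => by simp [hg]
  have hg2 : ∀ j, j ≠ k → ∀ x e, g (L.move j x e) = L.move j x (g e) :=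
    fun j hj x e => by simp [hg, hj]
  have hwall : ∀ c, Wall M L k b (g c) ↔ Wall M L k b c := fun c => wall_apply_iff hgb hg
  have hgw : ∀ c, Wall M L k b c → g c = L.move k (f (L.col c k)) c := by
    intro c hc
    induction hc with
    | base => rw [hgb, L.move_eq_self hfb.symm]
    | move_self x c _ ih => rw [hg1, ih, move_move, move_move, col_move_self]
    | move_comm j hj x c _ ih =>
      have hjk : j ≠ k := by
        rintro rfl
        simp at hj
      rw [hg2 j hjk, ih, L.col_move_ne hjk.symm, L.move_comm hM hΔ hj]
  -- So `g` permutes the wings by `f` and stabilises the wing of `b`.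
  have hgπ : ∀ c, π (g c) = f (π c) := by
    refine L.induction_move hΔ b (by rw [hgb, hπ b .base, hfb]) fun c i x ih => ?_
    by_cases hi : i = k ∧ Wall M L k b c
    · obtain ⟨rfl, hc⟩ := hi
      rw [hg1, hπ _ (hc.move_self x), hπ _ (((hwall c).2 hc).move_self _), col_move_self,
        col_move_self]
    · rw [hg, hπ' _ _ _ fun h => by rw [hwall]; exact fun hc => hi ⟨h, hc⟩, ih,
        hπ' _ _ _ fun h hc => hi ⟨h, hc⟩]
  have hgfix : ∀ c, π (g c) = L.col b k ↔ π c = L.col b k := by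
    intro c
    rw [hgπ]
    exact ⟨fun h => f.injective (h.trans hfb.symm), fun h => by rw [h, hfb]⟩
  -- Identity on the wing of `b`, and `g` elsewhere. The two agree where that wing meets the wall,
  -- so the `k`-panels crossing between wings have local action `f`.
  let h : Equiv.Perm C :=
    { toFun := fun c => if π c = L.col b k then c else g c
      invFun := fun c => if π c = L.col b k then c else g.symm c
      left_inv := fun c => by
        by_cases hc : π c = L.col b k
        · simp [hc]
        · simp [hc, hgfix]
      right_inv := fun c => by
        by_cases hc : π c = L.col b k
        · simp [hc]
        · have := hgfix (g.symm c)
          rw [Equiv.apply_symm_apply] at this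
          simp [hc, ← this] }
  have h1 : ∀ c, π c = L.col b k → h c = c := fun c hc => if_pos hc
  have h2 : ∀ c, π c ≠ L.col b k → h c = g c := fun c hc => if_neg hc
  have h3 : ∀ c, Wall M L k b c → h c = g c := by
    intro c hc
    by_cases hcb : π c = L.col b k
    · rw [h1 c hcb, hgw c hc, ← hπ c hc, hcb, hfb, L.move_eq_self]
      rw [← hπ c hc, hcb]
    · exact h2 c hcb
  obtain ⟨u, hu⟩ := L.exists_universalGroup_eq (F := F) h (by
    intro i c
    by_cases hi : i = k ∧ Wall M L k b c
    · obtain ⟨rfl, hc⟩ := hi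
      exact ⟨f, hf, fun x => by rw [h3 _ (hc.move_self x), h3 _ hc, hg1]⟩
    · have hm : ∀ x, π (L.move i x c) = π c := fun x => hπ' _ _ _ fun h hc => hi ⟨h, hc⟩
      by_cases hcb : π c = L.col b k
      · exact ⟨1, one_mem _, fun x => by rw [h1 _ ((hm x).trans hcb), h1 _ hcb]; rfl⟩
      · have hmx : ∀ x, h (L.move i x c) = g (L.move i x c) := fun x =>
          h2 _ fun h => hcb ((hm x).symm.trans h)
        by_cases hik : i = k
        · subst hik
          exact ⟨f, hf, fun x => by rw [hmx, h2 _ hcb, hg1]⟩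
        · exact ⟨1, one_mem _, fun x => by rw [hmx, h2 _ hcb, hg2 i hik]; rfl⟩)
  refine ⟨u, fun c hc => by rw [hu, h1 c hc], fun c hc => by rw [hu, h3 c hc, hgw c hc]⟩

end LegalColouring
end ChamberSystem

/-! ### Invariant equivalence relations and point stabilisers -/

/-- An action is preprimitive if and only if it is transitive and preserves no equivalence relation
other than equality and the universal relation. -/
theorem isPreprimitive_iff_forall_setoid {G Y : Type*} [Group G] [MulAction G Y] :
    MulAction.IsPreprimitive G Y ↔ MulAction.IsPretransitive G Y ∧
      ∀ r : Setoid Y, (∀ (g : G) x y, r x y → r (g • x) (g • y)) →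
        (∀ x y, r x y → x = y) ∨ ∀ x y, r x y := by
  constructor
  · refine fun h => ⟨h.toIsPretransitive, fun r hr => ?_⟩
    have hblock : ∀ y : Y, MulAction.IsBlock G {x | r x y} := by
      intro y
      rw [MulAction.isBlock_iff_smul_eq_of_mem]
      intro g x hx hgx
      have hgy : r (g • y) y := r.trans' (r.symm' (hr g _ _ hx)) hgx
      ext z
      rw [Set.mem_smul_set_iff_inv_smul_mem]
      constructor
      · intro hz
        have := hr g _ _ hz
        rw [smul_inv_smul] at this
        exact r.trans' this hgy
      · intro hz
        have := hr g⁻¹ _ _ (r.trans' hz (r.symm' hgy))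
        rwa [inv_smul_smul] at this
    by_cases huniv : ∃ y, {x | r x y} = Set.univ
    · obtain ⟨y, hy⟩ := huniv
      have hy' : ∀ x, r x y := fun x => hy.ge (Set.mem_univ x)
      exact Or.inr fun x z => r.trans' (hy' x) (r.symm' (hy' z))
    · refine Or.inl fun x y hxy => ?_
      exact (h.isTrivialBlock_of_isBlock (hblock y)).resolve_right (fun hu => huniv ⟨y, hu⟩)
        hxy (r.refl' y)
  · rintro ⟨htrans, h⟩
    refine { htrans with isTrivialBlock_of_isBlock := fun {B} hB => ?_ }
    -- Lying in the same translates of `B`. Since `B` is a block, its points are all related; if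
    -- everything is related, a nonempty `B` is the whole set.
    let r : Setoid Y :=
      { r := fun x y => ∀ g : G, x ∈ g • B ↔ y ∈ g • B
        iseqv := ⟨fun _ _ => Iff.rfl, fun h g => (h g).symm, fun h h' g => (h g).trans (h' g)⟩ }
    have hr : ∀ (g : G) x y, r x y → r (g • x) (g • y) := by
      intro g x y hxy g'
      have := hxy (g⁻¹ * g')
      simpa only [mul_smul, Set.mem_inv_smul_set_iff] using this
    rcases h r hr with h | h
    · refine Or.inl fun x hx y hy => h x y fun g => ?_
      have key : ∀ z ∈ B, z ∈ g • B → g • B = B := fun z hz hgz => by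
        by_contra hne
        exact Set.disjoint_left.1 (MulAction.isBlock_iff_disjoint_smul_of_ne.1 hB hne) hgz hz
      exact ⟨fun hc => by rwa [key _ hx hc], fun hd => by rwa [key _ hy hd]⟩
    · rcases B.eq_empty_or_nonempty with rfl | ⟨x, hx⟩
      · exact Or.inl Set.subsingleton_empty
      · refine Or.inr (Set.eq_univ_of_forall fun y => ?_)
        simpa using (h x y 1).1 (by simpa using hx)

/-- In a primitive non-regular permutation group, the stabiliser of a point fixes no other
point. -/
theorem exists_fix_and_move {Y : Type*} {H : Subgroup (Equiv.Perm Y)}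
    (hp : MulAction.IsPreprimitive H Y) (hr : ¬ IsRegularAction H Y) {x y : Y} (hxy : x ≠ y) :
    ∃ f ∈ H, f x = x ∧ f y ≠ y := by
  by_contra! hcon
  have : Nontrivial Y := ⟨x, y, hxy⟩
  have hle : MulAction.stabilizer H x ≤ MulAction.stabilizer H y := fun f hf => hcon f.1 f.2 hf
  have hco : ∀ z, IsCoatom (MulAction.stabilizer H z) := fun z =>
    (MulAction.isCoatom_stabilizer_iff_preprimitive H z).2 hp
  have heq : MulAction.stabilizer H x = MulAction.stabilizer H y := by
    by_contra hne
    exact (hco y).1 ((hco x).2 _ (lt_of_le_of_ne hle hne))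
  -- Having the same stabiliser is an invariant relation, and `x`, `y` are related by maximality of
  -- stabilisers. So all stabilisers coincide and are trivial.
  rcases (isPreprimitive_iff_forall_setoid.1 hp).2 (Setoid.ker (MulAction.stabilizer H))
    (fun g a b hab => by
      have hab : MulAction.stabilizer H a = MulAction.stabilizer H b := hab
      rw [Setoid.ker_def, MulAction.stabilizer_smul_eq_stabilizer_map_conj, hab,
        ← MulAction.stabilizer_smul_eq_stabilizer_map_conj]) with h | h
  · exact hxy (h x y heq)
  · refine hr ⟨hp.toIsPretransitive, fun a => (Subgroup.eq_bot_iff_forall _).2 fun f hf => ?_⟩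
    refine Subtype.ext (Equiv.ext fun b => ?_)
    have hb : MulAction.stabilizer H a = MulAction.stabilizer H b := h a b
    rw [hb] at hf
    exact hf

namespace ChamberSystem
namespace LegalColouring

variable {I C : Type*} {Δ : ChamberSystem I C}
variable {X : I → Type*} (L : Δ.LegalColouring X) {J : Set I}

/-! ### Residues -/

theorem mem_residueOf_iff {c d : C} :
    d ∈ Δ.residueOf J c ↔ ∃ w : List (Σ i, X i), (∀ a ∈ w, a.1 ∈ J) ∧ L.run w c = d := by
  constructor
  · rintro ⟨w, hw, h⟩
    obtain ⟨u, rfl, hu⟩ := L.exists_run_of_isGallery h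
    exact ⟨u, fun a ha => hw _ (List.mem_map_of_mem ha), hu⟩
  · rintro ⟨w, hw, h⟩
    induction w generalizing c with
    | nil => exact h ▸ mem_residueOf_self _ _
    | cons a w ih =>
      obtain ⟨u, hu, hd⟩ := ih (fun b hb => hw b (by simp [hb])) h
      by_cases hc : L.move a.1 a.2 c = c
      · exact ⟨u, hu, hc ▸ hd⟩
      · exact ⟨a.1 :: u, by simpa [hw a (by simp)] using hu, _, Ne.symm hc,
          L.equiv_move _ _ _, hd⟩

include L in
theorem mem_residueOf_trans {c d e : C} (hd : d ∈ Δ.residueOf J c) (he : e ∈ Δ.residueOf J d) :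
    e ∈ Δ.residueOf J c := by
  obtain ⟨v, hv, rfl⟩ := L.mem_residueOf_iff.1 hd
  obtain ⟨w, hw, rfl⟩ := L.mem_residueOf_iff.1 he
  exact L.mem_residueOf_iff.2 ⟨v ++ w, by simpa [or_imp, forall_and] using ⟨hv, hw⟩, by simp⟩

include L in
theorem mem_residueOf_symm {c d : C} (hd : d ∈ Δ.residueOf J c) : c ∈ Δ.residueOf J d := by
  obtain ⟨w, hw, rfl⟩ := L.mem_residueOf_iff.1 hd
  clear hd
  induction w generalizing c with
  | nil => exact mem_residueOf_self _ _
  | cons a w ih =>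
    refine L.mem_residueOf_trans (ih fun b hb => hw b (by simp [hb])) ?_
    exact L.mem_residueOf_iff.2 ⟨[⟨a.1, L.col c a.1⟩], by simpa using hw a (by simp),
      by simp [L.move_eq_self]⟩

theorem move_mem_residueOf {i : I} (hi : i ∈ J) (x : X i) (c : C) :
    L.move i x c ∈ Δ.residueOf J c :=
  L.mem_residueOf_iff.2 ⟨[⟨i, x⟩], by simpa using hi, rfl⟩

theorem run_mem_residueOf {w : List (Σ i, X i)} (hw : ∀ a ∈ w, a.1 ∈ J) (c : C) :
    L.run w c ∈ Δ.residueOf J c :=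
  L.mem_residueOf_iff.2 ⟨w, hw, rfl⟩

theorem col_eq_of_mem_residueOf {i : I} (hi : i ∉ J) {c d : C} (h : d ∈ Δ.residueOf J c) :
    L.col d i = L.col c i := by
  obtain ⟨w, hw, rfl⟩ := L.mem_residueOf_iff.1 h
  clear h
  induction w generalizing c with
  | nil => rfl
  | cons a w ih =>
    rw [run_cons, ih fun b hb => hw b (by simp [hb]), L.col_move_ne]
    rintro rfl
    exact hi (hw a (by simp))

theorem rel_of_mem_residueOf {E : Setoid C} (hE : ∀ i ∈ J, ∀ x c, E c (L.move i x c)) {c d : C}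
    (h : d ∈ Δ.residueOf J c) : E c d := by
  obtain ⟨w, hw, rfl⟩ := L.mem_residueOf_iff.1 h
  clear h
  induction w generalizing c with
  | nil => exact E.refl' c
  | cons a w ih =>
    exact E.trans' (hE a.1 (hw a (by simp)) a.2 c) (ih fun b hb => hw b (by simp [hb]))

include L in
theorem residueAt_eq_iff {c d : C} :
    Δ.residueAt J c = Δ.residueAt J d ↔ d ∈ Δ.residueOf J c := by
  constructor
  · intro h
    have : Δ.residueOf J c = Δ.residueOf J d := congrArg Subtype.val h
    exact this ▸ mem_residueOf_self _ _
  · intro h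
    refine Subtype.ext (Set.ext fun e => ⟨fun he => ?_, fun he => L.mem_residueOf_trans h he⟩)
    exact L.mem_residueOf_trans (L.mem_residueOf_symm h) he

/-! ### A criterion for primitivity on residues -/

variable {L} {F : ∀ i, Subgroup (Equiv.Perm (X i))}

theorem smul_residueAt (g : L.universalGroup F) (c : C) :
    g • Δ.residueAt J c = Δ.residueAt J (g.1.1 c) :=
  Subtype.ext (image_residueOf g.1.2 J c)

theorem apply_mem_residueOf (g : L.universalGroup F) {c d : C} (h : d ∈ Δ.residueOf J c) :
    g.1.1 d ∈ Δ.residueOf J (g.1.1 c) := by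
  rw [← image_residueOf g.1.2]
  exact ⟨d, h, rfl⟩

theorem isPretransitive_residue_iff :
    MulAction.IsPretransitive (L.universalGroup F) (Δ.Residue J) ↔
      ∀ c d, ∃ g : L.universalGroup F, d ∈ Δ.residueOf J (g.1.1 c) := by
  constructor
  · intro h c d
    obtain ⟨g, hg⟩ := h.exists_smul_eq (Δ.residueAt J c) (Δ.residueAt J d)
    rw [smul_residueAt, L.residueAt_eq_iff] at hg
    exact ⟨g, hg⟩
  · refine fun h => ⟨fun R S => ?_⟩
    obtain ⟨c, rfl⟩ := R.exists_eq_residueAt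
    obtain ⟨d, rfl⟩ := S.exists_eq_residueAt
    obtain ⟨g, hg⟩ := h c d
    exact ⟨g, by rw [smul_residueAt, L.residueAt_eq_iff]; exact hg⟩

variable (L J F) in
/-- An equivalence relation on chambers which is invariant under the universal group and for which
any two chambers of a `J`-residue are equivalent. -/
structure IsInvariant (E : Setoid C) : Prop where
  move : ∀ i ∈ J, ∀ x c, E c (L.move i x c)
  apply : ∀ (g : L.universalGroup F) c d, E c d → E (g.1.1 c) (g.1.1 d)

theorem isPreprimitive_residue_iff :
    MulAction.IsPreprimitive (L.universalGroup F) (Δ.Residue J) ↔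
      MulAction.IsPretransitive (L.universalGroup F) (Δ.Residue J) ∧
        ∀ E : Setoid C, IsInvariant L J F E →
          (∀ c d, E c d → d ∈ Δ.residueOf J c) ∨ ∀ c d, E c d := by
  rw [isPreprimitive_iff_forall_setoid]
  refine and_congr_right fun _ => ⟨fun h E hE => ?_, fun h r hr => ?_⟩
  · let r : Setoid (Δ.Residue J) :=
      { r := fun R S => ∀ c ∈ R.1, ∀ d ∈ S.1, E c d
        iseqv := by
          refine ⟨fun R c hc d hd => ?_, fun h c hc d hd => E.symm' (h d hd c hc), ?_⟩
          · obtain ⟨b, rfl⟩ := R.exists_eq_residueAt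
            exact L.rel_of_mem_residueOf hE.move
              (L.mem_residueOf_trans (L.mem_residueOf_symm hc) hd)
          · intro R S T h h' c hc d hd
            obtain ⟨b, rfl⟩ := S.exists_eq_residueAt
            exact E.trans' (h c hc b (mem_residueOf_self _ _)) (h' b (mem_residueOf_self _ _) d hd) }
    have hmem : ∀ c d : C, r (Δ.residueAt J c) (Δ.residueAt J d) ↔ E c d := fun c d =>
      ⟨fun h => h c (mem_residueOf_self _ _) d (mem_residueOf_self _ _), fun h c' hc d' hd =>
        E.trans' (E.symm' (L.rel_of_mem_residueOf hE.move hc))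
          (E.trans' h (L.rel_of_mem_residueOf hE.move hd))⟩
    refine (h r fun g R S hRS => ?_).imp (fun h c d hcd => ?_) fun h c d => ?_
    · obtain ⟨c, rfl⟩ := R.exists_eq_residueAt
      obtain ⟨d, rfl⟩ := S.exists_eq_residueAt
      rw [smul_residueAt, smul_residueAt, hmem]
      exact hE.apply g _ _ ((hmem _ _).1 hRS)
    · exact L.residueAt_eq_iff.1 (h _ _ ((hmem c d).2 hcd))
    · exact (hmem c d).1 (h _ _)
  · refine (h (r.comap (Δ.residueAt J)) ⟨fun i hi x c => ?_, fun g c d hcd => ?_⟩).imp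
      (fun h R S hRS => ?_) fun h R S => ?_
    · rw [Setoid.comap_rel, L.residueAt_eq_iff.2 (L.move_mem_residueOf hi x c)]
    · have := hr g _ _ hcd
      rwa [smul_residueAt, smul_residueAt] at this
    all_goals
      obtain ⟨c, rfl⟩ := R.exists_eq_residueAt
      obtain ⟨d, rfl⟩ := S.exists_eq_residueAt
    · exact L.residueAt_eq_iff.2 (h c d hRS)
    · exact h c d

end LegalColouring
end ChamberSystem

namespace ChamberSystem
namespace LegalColouring

variable {I C : Type*} {Δ : ChamberSystem I C} {M : CoxeterMatrix I} {X : I → Type*}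
  {L : Δ.LegalColouring X} {J : Set I} {F : ∀ i, Subgroup (Equiv.Perm (X i))} {k : I}

theorem exists_col_eq (hΔ : Δ.IsBuilding M) (L : Δ.LegalColouring X) {i : I} (x : X i) :
    ∃ c, L.col c i = x := by
  obtain ⟨c⟩ := hΔ.nonempty
  exact ⟨L.move i x c, L.col_move_self i x c⟩

/-! ### Necessity -/

/-- The equivalence relation generated by the moves of type in `J` and the moves
`c ↦ L.move k x c` with `Q c x`. -/
def moveSetoid (L : Δ.LegalColouring X) (J : Set I) (k : I) (Q : C → X k → Prop) : Setoid C :=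
  Relation.EqvGen.setoid fun c d =>
    (∃ i ∈ J, ∃ x, d = L.move i x c) ∨ ∃ x, Q c x ∧ d = L.move k x c

theorem moveSetoid_isInvariant {Q : C → X k → Prop}
    (hQ : ∀ (g : L.universalGroup F) (f : Equiv.Perm (X k)) c, f ∈ F k →
      (∀ x, g.1.1 (L.move k x c) = L.move k (f x) (g.1.1 c)) →
      ∀ x, Q c x → Q (g.1.1 c) (f x)) :
    IsInvariant L J F (moveSetoid L J k Q) := by
  refine ⟨fun i hi x c => Relation.EqvGen.rel _ _ (Or.inl ⟨i, hi, x, rfl⟩), ?_⟩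
  intro g c d h
  induction h with
  | rel c d h =>
    refine Relation.EqvGen.rel _ _ ?_
    rcases h with ⟨i, hi, x, rfl⟩ | ⟨x, hx, rfl⟩
    · obtain ⟨f, -, hf⟩ := L.exists_apply_move g i c
      exact Or.inl ⟨i, hi, f x, hf x⟩
    · obtain ⟨f, hfF, hf⟩ := L.exists_apply_move g k c
      exact Or.inr ⟨f x, hQ g f c hfF hf x hx, hf x⟩
  | refl c => exact Relation.EqvGen.refl _
  | symm c d _ ih => exact Relation.EqvGen.symm _ _ ih
  | trans c d e _ _ ih ih' => exact Relation.EqvGen.trans _ _ _ ih ih'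

theorem moveSetoid_le {Q : C → X k → Prop} {E : Setoid C}
    (hJ : ∀ i ∈ J, ∀ x c, E c (L.move i x c)) (hQ : ∀ c x, Q c x → E c (L.move k x c)) {c d : C}
    (h : moveSetoid L J k Q c d) : E c d := by
  induction h with
  | rel c d h =>
    rcases h with ⟨i, hi, x, rfl⟩ | ⟨x, hx, rfl⟩
    · exact hJ i hi x c
    · exact hQ c x hx
  | refl c => exact E.refl' _
  | symm c d _ ih => exact E.symm' ih
  | trans c d e _ _ ih ih' => exact E.trans' ih ih'

theorem moveSetoid_move {Q : C → X k → Prop} {c : C} {x : X k} (h : Q c x) :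
    moveSetoid L J k Q c (L.move k x c) :=
  Relation.EqvGen.rel _ _ (Or.inr ⟨x, h, rfl⟩)

theorem eq_of_move_mem_residueOf (hk : k ∉ J) {x : X k} {c : C}
    (h : L.move k x c ∈ Δ.residueOf J c) : x = L.col c k := by
  have := L.col_eq_of_mem_residueOf hk h
  rwa [col_move_self] at this

theorem exists_compl_eq_singleton (hΔ : Δ.IsBuilding M) (hX : Δ.IsSemiregular X)
    (hJ : J ⊂ Set.univ)
    (h : MulAction.IsPreprimitive (L.universalGroup F) (Δ.Residue J)) :
    ∃ k, Jᶜ = {k} := by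
  obtain ⟨k, -, hkJ⟩ := Set.exists_of_ssubset hJ
  refine ⟨k, Set.eq_singleton_iff_unique_mem.2 ⟨hkJ, fun l hl => ?_⟩⟩
  by_contra hlk
  obtain ⟨c⟩ := hΔ.nonempty
  have := (hX k).1
  have := (hX l).1
  obtain ⟨x, hx⟩ := exists_ne (L.col c k)
  obtain ⟨y, hy⟩ := exists_ne (L.col c l)
  -- Allow all `k`-moves. The classes exceed `J`-residues, yet colour `l` is constant on them.
  rcases (isPreprimitive_residue_iff.1 h).2 _
    (moveSetoid_isInvariant (k := k) (Q := fun _ _ => True) fun _ _ _ _ _ _ _ => trivial) with h | h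
  · exact hx (eq_of_move_mem_residueOf hkJ (h c (L.move k x c) (moveSetoid_move trivial)))
  · have h1 : Setoid.ker (fun c => L.col c l) c (L.move l y c) := by
      refine moveSetoid_le (fun i hi x c => ?_) (fun c x _ => ?_) (h c (L.move l y c))
      · refine (L.col_move_ne ?_ x c).symm
        rintro rfl
        exact hl hi
      · exact (L.col_move_ne hlk x c).symm
    rw [Setoid.ker_def, col_move_self] at h1
    exact hy h1.symm

theorem isPretransitive_of_residue (hΔ : Δ.IsBuilding M) (hk : k ∉ J)
    (h : MulAction.IsPretransitive (L.universalGroup F) (Δ.Residue J)) :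
    MulAction.IsPretransitive (F k) (X k) := by
  refine ⟨fun a b => ?_⟩
  obtain ⟨c, rfl⟩ := exists_col_eq hΔ L a
  obtain ⟨d, rfl⟩ := exists_col_eq hΔ L b
  obtain ⟨g, hg⟩ := isPretransitive_residue_iff.1 h c d
  obtain ⟨f, hfF, hf⟩ := L.exists_apply_move g k c
  refine ⟨⟨f, hfF⟩, ?_⟩
  have h1 := hf (L.col c k)
  rw [L.move_eq_self rfl] at h1
  rw [L.col_eq_of_mem_residueOf hk hg, h1, col_move_self]
  rfl

/-- If `a` and `y` lie in different orbits of `F i`, allow `k`-moves only where the `i`-colour is in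
the orbit of `a`. A wall through a chamber of `i`-colour `y` has constant `i`-colour and is never
crossed. -/
theorem isPretransitive_of_residue_of_eq_zero (hM : M.IsRightAngled) (hΔ : Δ.IsBuilding M)
    (hX : Δ.IsSemiregular X)
    (h : MulAction.IsPreprimitive (L.universalGroup F) (Δ.Residue {k}ᶜ)) {i : I}
    (hi : M i k = 0) : MulAction.IsPretransitive (F i) (X i) := by
  refine ⟨fun a y => ?_⟩
  by_contra! hcon
  have := (hX k).1
  have hik : i ≠ k := by
    rintro rfl
    simp at hi
  have hinv : IsInvariant L {k}ᶜ F
      (moveSetoid L {k}ᶜ k fun c _ => ∃ f ∈ F i, f a = L.col c i) := by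
    refine moveSetoid_isInvariant fun g _ c _ _ _ ⟨f, hf, hfa⟩ => ?_
    obtain ⟨f', hf', h'⟩ := L.exists_apply_move g i c
    have h1 := h' (L.col c i)
    rw [L.move_eq_self rfl] at h1
    refine ⟨f' * f, mul_mem hf' hf, ?_⟩
    rw [h1, col_move_self, Equiv.Perm.mul_apply, hfa]
  rcases (isPreprimitive_residue_iff.1 h).2 _ hinv with h | h
  · obtain ⟨c, rfl⟩ := exists_col_eq hΔ L a
    obtain ⟨x, hx⟩ := exists_ne (L.col c k)
    exact hx (eq_of_move_mem_residueOf (J := {k}ᶜ) (by simp)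
      (h c (L.move k x c) (moveSetoid_move ⟨1, one_mem _, rfl⟩)))
  · obtain ⟨b, rfl⟩ := exists_col_eq hΔ L y
    obtain ⟨x, hx⟩ := exists_ne (L.col b k)
    obtain ⟨π, hπ, hπ'⟩ := exists_wing L k b hM hΔ
    have h1 : Setoid.ker π b (L.move k x b) := by
      refine moveSetoid_le (fun j hj z c => ?_) (fun c z ⟨f, hf, hfa⟩ => ?_) (h b (L.move k x b))
      · exact (hπ' c j z fun h => (hj h).elim).symm
      · exact (hπ' c k z fun _ hc => hcon ⟨f, hf⟩ (hfa.trans (hc.col_eq hi))).symm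
    rw [Setoid.ker_def, hπ _ Wall.base, hπ _ (Wall.base.move_self x), col_move_self] at h1
    exact hx h1.symm

/-- Allow the `k`-moves between `r`-related colours; pulling `r` back along `π` bounds the generated
relation. -/
theorem isPreprimitive_of_residue (hM : M.IsRightAngled) (hΔ : Δ.IsBuilding M)
    (h : MulAction.IsPreprimitive (L.universalGroup F) (Δ.Residue {k}ᶜ)) :
    MulAction.IsPreprimitive (F k) (X k) := by
  rw [isPreprimitive_iff_forall_setoid]
  refine ⟨isPretransitive_of_residue hΔ (by simp) h.toIsPretransitive, fun r hr => ?_⟩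
  have hinv : IsInvariant L {k}ᶜ F (moveSetoid L {k}ᶜ k fun c x => r (L.col c k) x) := by
    refine moveSetoid_isInvariant fun g f c hfF hf x hx => ?_
    have h1 := hf (L.col c k)
    rw [L.move_eq_self rfl] at h1
    rw [h1, col_move_self]
    exact hr ⟨f, hfF⟩ _ _ hx
  refine ((isPreprimitive_residue_iff.1 h).2 _ hinv).imp (fun h x y hxy => ?_) fun h x y => ?_
  · obtain ⟨c, rfl⟩ := exists_col_eq hΔ L x
    exact (eq_of_move_mem_residueOf (J := {k}ᶜ) (by simp)
      (h c (L.move k y c) (moveSetoid_move hxy))).symm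
  · obtain ⟨b, rfl⟩ := exists_col_eq hΔ L x
    obtain ⟨π, hπ, hπ'⟩ := exists_wing L k b hM hΔ
    have h1 : r.comap π b (L.move k y b) := by
      refine moveSetoid_le (fun j hj z c => ?_) (fun c z hz => ?_) (h b (L.move k y b))
      · rw [Setoid.comap_rel, hπ' c j z fun h => (hj h).elim]
      · rw [Setoid.comap_rel]
        by_cases hc : Wall M L k b c
        · rwa [hπ _ hc, hπ _ (hc.move_self z), col_move_self]
        · rw [hπ' c k z fun _ => hc]
    rwa [Setoid.comap_rel, hπ _ Wall.base, hπ _ (Wall.base.move_self y), col_move_self] at h1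

/-- For regular `F k`, a local permutation is determined by one value, so each group element acts on
`k`-colours by a single permutation and equality of `k`-colours is invariant. -/
theorem not_isRegularAction_of_residue (hM : M.IsRightAngled) (hΔ : Δ.IsBuilding M)
    (hX : Δ.IsSemiregular X) (hk : ∃ i, M i k = 0)
    (h : MulAction.IsPreprimitive (L.universalGroup F) (Δ.Residue {k}ᶜ)) :
    ¬ IsRegularAction (F k) (X k) := by
  intro hreg
  obtain ⟨b⟩ := hΔ.nonempty
  have := (hX k).1
  have huniq : ∀ f ∈ F k, ∀ f' ∈ F k, ∀ x, f x = f' x → f = f' := by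
    intro f hf f' hf' x hx
    have h1 : (⟨f', hf'⟩⁻¹ * ⟨f, hf⟩ : F k) ∈ MulAction.stabilizer (F k) x := by
      rw [MulAction.mem_stabilizer_iff, mul_smul, inv_smul_eq_iff]
      exact hx
    rw [hreg.2 x, Subgroup.mem_bot, inv_mul_eq_one] at h1
    exact (congrArg Subtype.val h1).symm
  have hinv : IsInvariant L {k}ᶜ F (Setoid.ker fun c => L.col c k) := by
    refine ⟨fun i hi x c => (L.col_move_ne (Ne.symm hi) x c).symm, fun g c d hcd => ?_⟩
    obtain ⟨f, hfF, hf⟩ := L.exists_apply_move g k b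
    have key : ∀ c, L.col (g.1.1 c) k = f (L.col c k) := by
      refine L.induction_move hΔ b ?_ fun c i x ih => ?_
      · have h1 := hf (L.col b k)
        rw [L.move_eq_self rfl] at h1
        rw [h1, col_move_self]
      · obtain ⟨f', hfF', hf'⟩ := L.exists_apply_move g i c
        by_cases hi : k = i
        · subst hi
          have h1 := hf' (L.col c k)
          rw [L.move_eq_self rfl] at h1
          rw [h1, col_move_self] at ih
          rw [hf', col_move_self, col_move_self, huniq f' hfF' f hfF _ ih]
        · rw [hf', L.col_move_ne hi, L.col_move_ne hi, ih]
    rw [Setoid.ker_def, key, key]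
    exact congrArg f hcd
  rcases (isPreprimitive_residue_iff.1 h).2 _ hinv with h | h
  · obtain ⟨i, hi⟩ := hk
    have := (hX i).1
    have hik : i ≠ k := by
      rintro rfl
      simp at hi
    obtain ⟨y, hy⟩ := exists_ne (L.col b k)
    obtain ⟨z, hz⟩ := exists_ne (L.col b i)
    obtain ⟨π, hπ, hπ'⟩ := exists_wing L k b hM hΔ
    -- The two chambers share their `k`-colour, but the `i`-move leaves the wall of `b`, so the
    -- later `k`-move does not change `π`.
    have h1 : Setoid.ker π (L.move k y b) (L.move k y (L.move i z b)) := by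
      refine L.rel_of_mem_residueOf (J := {k}ᶜ) (fun j hj x c => ?_) (h _ _ ?_)
      · exact (hπ' c j x fun h => (hj h).elim).symm
      · simp [Setoid.ker_def]
    rw [Setoid.ker_def, hπ _ (Wall.base.move_self y), col_move_self, hπ' (L.move i z b) k y,
      hπ' b i z fun h => (hik h).elim, hπ _ Wall.base] at h1
    · exact hy h1
    · intro _ hw
      have := hw.col_eq hi
      rw [col_move_self] at this
      exact hz this
  · obtain ⟨y, hy⟩ := exists_ne (L.col b k)
    have h1 := h b (L.move k y b)
    rw [Setoid.ker_def, col_move_self] at h1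
    exact hy h1.symm

/-! ### Sufficiency -/

theorem isPretransitive_residue (hM : M.IsRightAngled) (hΔ : Δ.IsBuilding M)
    (h : MulAction.IsPretransitive (F k) (X k)) :
    MulAction.IsPretransitive (L.universalGroup F) (Δ.Residue {k}ᶜ) := by
  refine isPretransitive_residue_iff.2 fun c =>
    L.induction_move hΔ c ⟨1, mem_residueOf_self _ _⟩ fun d i x ⟨g, hg⟩ => ?_
  by_cases hi : i = k
  · subst hi
    obtain ⟨⟨f, hf⟩, hfx⟩ := h.exists_smul_eq (L.col d i) x
    obtain ⟨g', hg', -⟩ := L.exists_extension hM hΔ F hf d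
    refine ⟨g' * g, ?_⟩
    have hfx : f (L.col d i) = x := hfx
    rw [← hfx, ← hg']
    exact apply_mem_residueOf g' hg
  · exact ⟨g, L.mem_residueOf_trans hg (L.move_mem_residueOf hi x d)⟩

/-- The residue of `d` of type `{k}ᶜ` is reached from `c` by a gallery with at most `n` moves of
type `k`. -/
inductive Reaches (L : Δ.LegalColouring X) (k : I) (c : C) : ℕ → C → Prop
  | zero (d : C) : d ∈ Δ.residueOf {k}ᶜ c → Reaches L k c 0 d
  | succ (n : ℕ) (e : C) (x : X k) (d : C) : Reaches L k c n e →
      d ∈ Δ.residueOf {k}ᶜ (L.move k x e) → Reaches L k c (n + 1) d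

theorem Reaches.trans {n : ℕ} {c d e : C} (h : Reaches L k c n d)
    (he : e ∈ Δ.residueOf {k}ᶜ d) : Reaches L k c n e := by
  cases h with
  | zero _ h => exact .zero _ (L.mem_residueOf_trans h he)
  | succ n b x _ h hd => exact .succ n b x _ h (L.mem_residueOf_trans hd he)

theorem exists_reaches (hΔ : Δ.IsBuilding M) (L : Δ.LegalColouring X) (k : I) (c : C) :
    ∀ d, ∃ n, Reaches L k c n d := by
  refine L.induction_move hΔ c ⟨0, .zero _ (mem_residueOf_self _ _)⟩ fun d i x ⟨n, h⟩ => ?_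
  by_cases hi : i = k
  · subst hi
    exact ⟨n + 1, .succ n d x _ h (mem_residueOf_self _ _)⟩
  · exact ⟨n, h.trans (L.move_mem_residueOf hi x d)⟩

theorem wing_eq_of_mem_residueOf {b : C} {π : C → X k}
    (hπ' : ∀ c i x, (i = k → ¬ Wall M L k b c) → π (L.move i x c) = π c) {c d : C}
    (h : d ∈ Δ.residueOf {k}ᶜ c) : π c = π d :=
  L.rel_of_mem_residueOf (E := Setoid.ker π)
    (fun i hi x c => (hπ' c i x fun h => (hi h).elim).symm) h

theorem Reaches.exists_wall {b : C} {π : C → X k} (hπ : ∀ c, Wall M L k b c → π c = L.col c k)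
    (hπ' : ∀ c i x, (i = k → ¬ Wall M L k b c) → π (L.move i x c) = π c) {n : ℕ} {c e : C}
    (h : Reaches L k c n e) (hne : π e ≠ π c) :
    ∃ m ≤ n, ∃ e', Reaches L k c m e' ∧ Wall M L k b e' ∧ L.col e' k = π c := by
  induction h with
  | zero e h => exact (hne (wing_eq_of_mem_residueOf hπ' h).symm).elim
  | succ n e₀ x e h he ih =>
    by_cases h0 : π e₀ = π c
    · have hw : Wall M L k b e₀ := by
        by_contra hw
        rw [← wing_eq_of_mem_residueOf hπ' he, hπ' e₀ k x fun _ => hw] at hne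
        exact hne h0
      exact ⟨n, by omega, e₀, h, hw, by rw [← hπ _ hw, h0]⟩
    · obtain ⟨m, hm, e', h'⟩ := ih h0
      exact ⟨m, by omega, e', h'⟩

/-- The wall of the last `k`-move separates when the number of `k`-moves from `c` to the residue of
`c'` is minimal. -/
theorem exists_wing_ne (hM : M.IsRightAngled) (hΔ : Δ.IsBuilding M) {c c' : C}
    (h : c' ∉ Δ.residueOf {k}ᶜ c) :
    ∃ d ∈ Δ.residueOf {k}ᶜ c', ∃ π : C → X k, (∀ e, Wall M L k d e → π e = L.col e k) ∧
      (∀ e i x, (i = k → ¬ Wall M L k d e) → π (L.move i x e) = π e) ∧ π c ≠ L.col d k := by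
  obtain ⟨n, hn⟩ := exists_reaches hΔ L k c c'
  induction n using Nat.strong_induction_on with
  | _ n ih =>
    cases hn with
    | zero _ hc => exact (h hc).elim
    | succ n e x _ he hc' =>
      by_cases hx : L.col e k = x
      · rw [L.move_eq_self hx] at hc'
        exact ih n (by omega) (he.trans hc')
      obtain ⟨π, hπ, hπ'⟩ := exists_wing L k (L.move k x e) hM hΔ
      by_cases hc : π c = x
      -- If `c` were in the wing of colour `x`, the route to `e` would leave that wing at a wall
      -- chamber `e'`. From `e'` the end of the last `k`-move is reached by moves commuting with
      -- `k`, saving a `k`-move.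
      · have hwe : Wall M L k (L.move k x e) e := (wall_move_iff (Or.inl rfl) x e).1 Wall.base
        obtain ⟨m, hm, e', h1, h2, h3⟩ := he.exists_wall hπ hπ' (by rwa [hπ e hwe, hc])
        obtain ⟨v, hv, hv'⟩ := h2.exists_run_of_col_eq hM hΔ Wall.base (by rw [h3, hc, col_move_self])
        have hmem : L.run v e' ∈ Δ.residueOf {k}ᶜ e' := by
          refine L.run_mem_residueOf (fun a ha => ?_) e'
          rintro hak
          have h4 := hv a ha
          rw [Set.mem_singleton_iff.1 hak] at h4
          simp at h4
        rw [hv'] at hmem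
        exact ih m (by omega) ((h1.trans hmem).trans hc')
      · exact ⟨L.move k x e, L.mem_residueOf_symm hc', π, hπ, hπ', by rwa [col_move_self]⟩

theorem wall_move_base_iff {b : C} (x : X k) (c : C) :
    Wall M L k (L.move k x b) c ↔ Wall M L k b c := by
  have key : ∀ (x : X k) (b : C), Wall M L k (L.move k x b) c → Wall M L k b c := by
    intro x b h
    induction h with
    | base => exact Wall.base.move_self x
    | move_self y c _ ih => exact ih.move_self y
    | move_comm j hj y c _ ih => exact ih.move_comm j hj y
  refine ⟨key x b, fun h => key (L.col b k) _ ?_⟩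
  rwa [move_move, L.move_eq_self rfl]

theorem isPreprimitive_residue (hM : M.IsRightAngled) (hΔ : Δ.IsBuilding M)
    (hp : MulAction.IsPreprimitive (F k) (X k)) (hr : ¬ IsRegularAction (F k) (X k))
    (ht : ∀ i, M i k = 0 → MulAction.IsPretransitive (F i) (X i)) :
    MulAction.IsPreprimitive (L.universalGroup F) (Δ.Residue {k}ᶜ) := by
  refine isPreprimitive_residue_iff.2 ⟨isPretransitive_residue hM hΔ hp.toIsPretransitive,
    fun E hE => or_iff_not_imp_left.2 fun hne => ?_⟩
  push Not at hne
  obtain ⟨c, c', hcc', hc'⟩ := hne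
  obtain ⟨d, hd, π, hπ, hπ', hcd⟩ := exists_wing_ne (L := L) hM hΔ hc'
  have hEcd : E c d := E.trans' hcc' (L.rel_of_mem_residueOf hE.move hd)
  obtain ⟨f, hf, hfx, hfy⟩ := exists_fix_and_move hp hr hcd
  -- This base lies in the wall of `d` but has colour `π c`, so `g` fixes `c` while moving `d` in
  -- its `k`-panel.
  obtain ⟨g, hg, hg'⟩ := exists_wing_extension (b := L.move k (π c) d) hM hΔ F hf
    (by rwa [col_move_self]) (π := π) (by simpa only [wall_move_base_iff] using hπ)
    (by simpa only [wall_move_base_iff] using hπ')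
  have hEd : E d (L.move k (f (L.col d k)) d) := by
    refine E.trans' (E.symm' hEcd) ?_
    have := hE.apply g _ _ hEcd
    rwa [hg c (by rw [col_move_self]), hg' d ((wall_move_base_iff _ _).2 Wall.base)] at this
  have hpanel : ∀ a b, E (L.move k a d) (L.move k b d) := by
    refine ((isPreprimitive_iff_forall_setoid.1 hp).2 (E.comap fun a => L.move k a d)
      fun ⟨s, hs⟩ a b hab => ?_).resolve_left fun h => ?_
    · obtain ⟨u, hu, hu', -⟩ := L.exists_extension hM hΔ F hs d
      have := hE.apply u _ _ hab
      rwa [hu', hu', hu, move_move, move_move] at this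
    · refine hfy (h _ _ ?_).symm
      rwa [Setoid.comap_rel, L.move_eq_self rfl]
  -- Commuting `i`-moves carry the collapse by `move_comm`; for `m i k = ∞` a group element taking
  -- `e` to the neighbouring chamber and preserving `k`-colours carries it.
  have hall : ∀ e a b, E (L.move k a e) (L.move k b e) := by
    refine L.induction_move hΔ d hpanel fun e i x ih a b => ?_
    by_cases hik : i = k
    · subst hik
      simpa using ih a b
    rcases hM i k hik with hi | hi
    · rw [← L.move_comm hM hΔ hi, ← L.move_comm hM hΔ hi]
      exact E.trans' (E.symm' (hE.move i hik x _)) (E.trans' (ih a b) (hE.move i hik x _))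
    · obtain ⟨⟨s, hs⟩, hsx⟩ := (ht i hi).exists_smul_eq (L.col e i) x
      have hsx : s (L.col e i) = x := hsx
      obtain ⟨u, hu, -, hu'⟩ := L.exists_extension hM hΔ F hs e
      have := hE.apply u _ _ (ih a b)
      rwa [hu' k (Ne.symm hik), hu' k (Ne.symm hik), hu, hsx] at this
  intro c
  refine L.induction_move hΔ c (E.refl' c) fun e i x ih => E.trans' ih ?_
  by_cases hik : i = k
  · subst hik
    have := hall e (L.col e i) x
    rwa [L.move_eq_self rfl] at this
  · exact hE.move i hik x e

end LegalColouring
end ChamberSystem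

theorem mainTheorem3 {I : Type*} [Finite I] (M : CoxeterMatrix I) (hM : M.IsRightAngled)
    {C : Type*} (Δ : ChamberSystem I C) (hΔ : Δ.IsBuilding M)
    {X : I → Type*} (hX : Δ.IsSemiregular X) (L : Δ.LegalColouring X)
    (F : ∀ i, Subgroup (Equiv.Perm (X i)))
    (J : Set I) (hJ : J ⊂ Set.univ)
    (hk : ∀ k : I, Jᶜ = {k} → ∃ i, M i k = 0) :
    MulAction.IsPreprimitive (L.universalGroup F) (Δ.Residue J) ↔
      ∃ k : I, Jᶜ = {k} ∧
        (MulAction.IsPreprimitive (F k) (X k) ∧ ¬ IsRegularAction (F k) (X k)) ∧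
        ∀ i : I, M i k = 0 → MulAction.IsPretransitive (F i) (X i) := by
  constructor
  · intro h
    obtain ⟨k, hJk⟩ := ChamberSystem.LegalColouring.exists_compl_eq_singleton hΔ hX hJ h
    have hk' := hk k hJk
    obtain rfl : J = {k}ᶜ := by rw [← hJk, compl_compl]
    exact ⟨k, hJk, ⟨ChamberSystem.LegalColouring.isPreprimitive_of_residue hM hΔ h,
      ChamberSystem.LegalColouring.not_isRegularAction_of_residue hM hΔ hX hk' h⟩,
      fun i hi => ChamberSystem.LegalColouring.isPretransitive_of_residue_of_eq_zero hM hΔ hX h hi⟩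
  · rintro ⟨k, hJk, ⟨hp, hr⟩, ht⟩
    obtain rfl : J = {k}ᶜ := by rw [← hJk, compl_compl]
    exact ChamberSystem.LegalColouring.isPreprimitive_residue hM hΔ hp hr ht
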